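/- Recall that the nonnegative rank of a matrix with nonnegative real entries is the smallest $k$ such that the matrix is a sum of $k$ nonnegative matrices of rank one. Let $A$ be a real $m\times n$ matrix with nonnegative entries and with (ordinary) rank equal to $3$. (a) If $\ln\ln\ln\ln\ln\ln m$ is defined and positive, that is, if $m>\exp\exp\exp\exp\exp 1$, then the nonnegative rank of $A$ is at most $$25\,m\,\bigl(\ln\ln\ln\ln\ln\ln m\bigr)^{-1/2}.$$ (b) Consequently the nonnegative rank of such matrices is $o(m)$ and also $o(n)$, uniformly over all of them: there is a function $f:\mathbb{N}\to\mathbb{R}$ with $f(k)=o(k)$ as $k\to\infty$ such that, for all $m,n$ and every nonnegative $m\times n$ matrix $A$ of rank $3$, the nonnegative rank of $A$ is at most $f(m)$ and at most $f(n)$. -/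

import Mathlib

open Asymptotics

/-- `M` is a sum of `k` entrywise nonnegative matrices of rank one. -/
def IsSumOfNonnegRankOne {m n : Type*} [Fintype n] (M : Matrix m n ℝ) (k : ℕ) : Prop :=
  ∃ N : Fin k → Matrix m n ℝ,
    (∀ l, (∀ i j, 0 ≤ N l i j) ∧ (N l).rank = 1) ∧ M = ∑ l, N l

/-- The nonnegative rank of a nonnegative matrix: the smallest `k` such that the matrix is a sum
of `k` nonnegative matrices of rank one (a minimum, by `isSumOfNonnegRankOne_nonnegRank`). -/
noncomputable def nonnegRank {m n : Type*} [Fintype n] (M : Matrix m n ℝ) : ℕ :=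
  sInf {k : ℕ | IsSumOfNonnegRankOne M k}

theorem rank_single_eq_one {m n : Type*} [Fintype n] [DecidableEq m] [DecidableEq n]
    (i : m) (j : n) {a : ℝ} (ha : a ≠ 0) : (Matrix.single i j a).rank = 1 := by
  apply le_antisymm
  · have h : Matrix.single i j a = Matrix.vecMulVec (Pi.single i a) (Pi.single j (1 : ℝ)) := by
      ext i' j'
      by_cases h1 : i = i' <;> by_cases h2 : j = j' <;>
        simp_all [Matrix.vecMulVec_apply, eq_comm]
    rw [h]
    exact Matrix.rank_vecMulVec_le _ _
  · rw [Nat.one_le_iff_ne_zero, Ne, Matrix.rank, Submodule.finrank_eq_zero,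
      LinearMap.range_eq_bot]
    intro h
    apply ha
    have := congrFun (LinearMap.congr_fun h (Pi.single j 1)) i
    simpa using this

/-- Every nonnegative matrix is a sum of its `nonnegRank` many nonnegative rank one matrices. -/
theorem isSumOfNonnegRankOne_nonnegRank {m n : Type*} [Fintype m] [Fintype n]
    (M : Matrix m n ℝ) (hM : ∀ i j, 0 ≤ M i j) : IsSumOfNonnegRankOne M (nonnegRank M) := by
  classical
  apply Nat.sInf_mem (s := {k : ℕ | IsSumOfNonnegRankOne M k})
  let e := Fintype.equivFin {p : m × n // M p.1 p.2 ≠ 0}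
  refine ⟨_, fun l => Matrix.single (e.symm l).1.1 (e.symm l).1.2
    (M (e.symm l).1.1 (e.symm l).1.2), fun l => ⟨fun i j => ?_, ?_⟩, ?_⟩
  · change 0 ≤ Matrix.single (e.symm l).1.1 (e.symm l).1.2 _ i j
    rw [Matrix.single_apply]
    split_ifs
    · exact hM _ _
    · exact le_rfl
  · exact rank_single_eq_one _ _ (e.symm l).2
  · rw [Equiv.sum_comp e.symm (fun p : {p : m × n // M p.1 p.2 ≠ 0} =>
      Matrix.single p.1.1 p.1.2 (M p.1.1 p.1.2))]
    have h : ∑ p : {p : m × n // M p.1 p.2 ≠ 0}, Matrix.single p.1.1 p.1.2 (M p.1.1 p.1.2)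
        = ∑ p : m × n, Matrix.single p.1 p.2 (M p.1 p.2) := by
      rw [← Finset.sum_subtype (Finset.univ.filter fun p : m × n => M p.1 p.2 ≠ 0)
        (fun p => by simp) (fun p : m × n => Matrix.single p.1 p.2 (M p.1 p.2))]
      refine Finset.sum_filter_of_ne fun p _ hp h0 => hp ?_
      rw [h0, Matrix.single_zero]
    rw [h, Fintype.sum_prod_type]
    exact Matrix.matrix_eq_sum_single M

/-! Divide each nonzero row by its row sum. As the rank is 3, the rows become points of the plane
and the columns become affine functions nonnegative at those points. Rows that are nonnegative
combinations of other rows cost nothing, so a minimal generating set suffices; its points are in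
convex position, and half of them form, up to reflection, a strictly convex chain
(`exists_chain_rows`).

An affine function nonnegative on a chain is a nonnegative combination of heights above the edges
and three further functions (`IsConvexChain.affine_mem`), so the edge heights have to be generated
economically. Cut `q * k` points into `k` groups of `q`. If the heights above the `j`-th edges of
all groups can be scaled so that on each group its own edge is lowest (`IsTame.exists_potential`),
then glue these scaled minima into one function for each `j`. The error on each group is a
difference of two heights and is a combination of three functions supported there
(`IsConvexChain.indicator_mem`). This gives about `q + 4k` generators for `q * k` rows.

The scaling exists when ratios of heights above an earlier and a later edge are monotone (`IsTame`).
Whether this holds is a two-colouring of 6-tuples on each of two patterns; Ramsey's theorem makes it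
constant on a subchain, and 13 points cannot be bad throughout (`IsConvexChain.exists_ratioLE`).

With `q = k`, peeling off blocks of `k * k` rows gives `6 * m / k` plus twice a Ramsey number. That
number is a tower in `k * k`, so taking `k` near the square root of the sixfold logarithm keeps it
far below `m`. -/

open scoped NNReal

/-! ### Convex chains: slopes and heights. -/

/-- The points `(x a, y a)`, `a < N`, form a strictly convex chain. -/
structure IsConvexChain (N : ℕ) (x y : ℕ → ℝ) : Prop where
  lt : ∀ {a b}, a < b → b < N → x a < x b
  convex : ∀ {a b c}, a < b → b < c → c < N →
    (y b - y a) * (x c - x b) < (y c - y b) * (x b - x a)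

/-- The slope of the line through the points `a` and `b`. -/
noncomputable def chordSlope (x y : ℕ → ℝ) (a b : ℕ) : ℝ := (y b - y a) / (x b - x a)

/-- The height of the point `p` above the line through the points `a` and `b`. -/
noncomputable def heightAbove (x y : ℕ → ℝ) (a b p : ℕ) : ℝ :=
  y p - y a - chordSlope x y a b * (x p - x a)

theorem heightAbove_left (x y : ℕ → ℝ) (a b : ℕ) : heightAbove x y a b a = 0 := by
  simp [heightAbove]

namespace IsConvexChain

variable {N : ℕ} {x y : ℕ → ℝ} (h : IsConvexChain N x y)
include h

theorem le {a b : ℕ} (hab : a ≤ b) (hb : b < N) : x a ≤ x b := by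
  rcases hab.eq_or_lt with rfl | hab
  · exact le_rfl
  · exact (h.lt hab hb).le

theorem slope_mul {a b : ℕ} (hab : a < b) (hb : b < N) :
    chordSlope x y a b * (x b - x a) = y b - y a :=
  div_mul_cancel₀ _ (sub_pos.2 (h.lt hab hb)).ne'

theorem slope_lt {a b c : ℕ} (hab : a < b) (hbc : b < c) (hc : c < N) :
    chordSlope x y a b < chordSlope x y b c := by
  have h1 := sub_pos.2 (h.lt hab (hbc.trans hc))
  have h2 := sub_pos.2 (h.lt hbc hc)
  rw [chordSlope, chordSlope, div_lt_div_iff₀ h1 h2]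
  exact h.convex hab hbc hc

theorem slope_le {a b c d : ℕ} (hab : a < b) (hbc : b ≤ c) (hcd : c < d) (hd : d < N) :
    chordSlope x y a b ≤ chordSlope x y c d := by
  rcases hbc.eq_or_lt with rfl | hbc
  · exact (h.slope_lt hab hcd hd).le
  · exact ((h.slope_lt hab hbc (hcd.trans hd)).trans (h.slope_lt hbc hcd hd)).le

theorem height_right {a b : ℕ} (hab : a < b) (hb : b < N) : heightAbove x y a b b = 0 := by
  rw [heightAbove, h.slope_mul hab hb]; ring

theorem height_of_lt {a b p : ℕ} (hpa : p < a) (ha : a < N) :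
    heightAbove x y a b p = (chordSlope x y a b - chordSlope x y p a) * (x a - x p) := by
  have := h.slope_mul hpa ha
  rw [heightAbove, sub_mul, this]; ring

theorem height_of_gt {a b p : ℕ} (hab : a < b) (hbp : b < p) (hp : p < N) :
    heightAbove x y a b p = (chordSlope x y b p - chordSlope x y a b) * (x p - x b) := by
  have h1 := h.slope_mul hab (hbp.trans hp)
  have h2 := h.slope_mul hbp hp
  rw [heightAbove, sub_mul, h2]; linear_combination -h1

theorem height_pos_of_lt {a b p : ℕ} (hpa : p < a) (hab : a < b) (hb : b < N) :
    0 < heightAbove x y a b p := by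
  rw [h.height_of_lt hpa (hab.trans hb)]
  exact mul_pos (sub_pos.2 (h.slope_lt hpa hab hb)) (sub_pos.2 (h.lt hpa (hab.trans hb)))

theorem height_pos_of_gt {a b p : ℕ} (hab : a < b) (hbp : b < p) (hp : p < N) :
    0 < heightAbove x y a b p := by
  rw [h.height_of_gt hab hbp hp]
  exact mul_pos (sub_pos.2 (h.slope_lt hab hbp hp)) (sub_pos.2 (h.lt hbp hp))

theorem height_nonneg {a b p : ℕ} (hab : a < b) (hb : b < N) (hp : p < N)
    (hpab : p ≤ a ∨ b ≤ p) : 0 ≤ heightAbove x y a b p := by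
  rcases hpab with hpa | hbp
  · rcases hpa.eq_or_lt with rfl | hpa
    · rw [heightAbove_left]
    · exact (h.height_pos_of_lt hpa hab hb).le
  · rcases hbp.eq_or_lt with rfl | hbp
    · rw [h.height_right hab hb]
    · exact (h.height_pos_of_gt hab hbp hp).le

theorem height_succ_nonneg {a p : ℕ} (ha : a + 1 < N) (hp : p < N) :
    0 ≤ heightAbove x y a (a + 1) p :=
  h.height_nonneg (Nat.lt_succ_self a) ha hp (by omega)

theorem height_mono {a b p p' : ℕ} (hab : a < b) (hbp : b ≤ p) (hpp : p ≤ p') (hp : p' < N) :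
    heightAbove x y a b p ≤ heightAbove x y a b p' := by
  rcases hpp.eq_or_lt with rfl | hpp
  · exact le_rfl
  have h1 := h.slope_mul hpp hp
  have h2 := mul_nonneg (sub_nonneg.2 (h.slope_le hab hbp hpp hp))
    (sub_pos.2 (h.lt hpp hp)).le
  simp only [heightAbove]
  linarith

theorem height_anti {a b p p' : ℕ} (hab : a < b) (hb : b < N) (hpp : p ≤ p') (hp : p' ≤ a) :
    heightAbove x y a b p' ≤ heightAbove x y a b p := by
  rcases hpp.eq_or_lt with rfl | hpp
  · exact le_rfl
  have ha := hab.trans hb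
  have h1 := h.slope_mul hpp (hp.trans_lt ha)
  have h2 := mul_nonneg (sub_nonneg.2 (h.slope_le hpp hp hab hb))
    (sub_pos.2 (h.lt hpp (hp.trans_lt ha))).le
  simp only [heightAbove]
  linarith

/-- Left of an edge, a later edge is lower by a definite amount. -/
theorem height_add_le_of_le {a b c d p : ℕ} (hab : a < b) (hbc : b ≤ c) (hcd : c < d) (hd : d < N) :
    heightAbove x y a b p + (chordSlope x y c d - chordSlope x y a b) * (x b - x p)
      ≤ heightAbove x y c d p := by
  have h1 := h.height_nonneg hcd hd (by omega : b < N) (Or.inl hbc)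
  have h2 := h.height_right hab (by omega)
  simp only [heightAbove] at *
  linarith

/-- Right of an edge, an earlier edge is lower by a definite amount. -/
theorem height_add_le_of_ge {a b c d p : ℕ} (hab : a < b) (hbc : b ≤ c) (hcd : c < d) (hd : d < N) :
    heightAbove x y c d p + (chordSlope x y c d - chordSlope x y a b) * (x p - x c)
      ≤ heightAbove x y a b p := by
  have h1 := h.height_nonneg hab (by omega) (by omega : c < N) (Or.inr hbc)
  simp only [heightAbove] at *
  linarith

theorem height_le_of_le {a b c d p : ℕ} (hab : a < b) (hbc : b ≤ c) (hcd : c < d) (hd : d < N)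
    (hp : p ≤ b) : heightAbove x y a b p ≤ heightAbove x y c d p := by
  have h1 := h.height_add_le_of_le (p := p) hab hbc hcd hd
  have h2 := mul_nonneg (sub_nonneg.2 (h.slope_le hab hbc hcd hd))
    (sub_nonneg.2 (h.le hp (by omega)))
  linarith

theorem height_le_of_ge {a b c d p : ℕ} (hab : a < b) (hbc : b ≤ c) (hcd : c < d) (hd : d < N)
    (hp : c ≤ p) (hpN : p < N) : heightAbove x y c d p ≤ heightAbove x y a b p := by
  have h1 := h.height_add_le_of_ge (p := p) hab hbc hcd hd
  have h2 := mul_nonneg (sub_nonneg.2 (h.slope_le hab hbc hcd hd))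
    (sub_nonneg.2 (h.le hp hpN))
  linarith

end IsConvexChain

/-! ### Ratios of heights and the thirteen-point obstruction. -/

/-- The ratio of the heights above the lines `ab` and `cd` does not decrease from `p` to `p'`. -/
def RatioLE (x y : ℕ → ℝ) (a b c d p p' : ℕ) : Prop :=
  heightAbove x y a b p * heightAbove x y c d p' ≤ heightAbove x y c d p * heightAbove x y a b p'

/-- The first two bounds follow because at `p` the line `ab` gives at most the height of `cd`, and
the height above `cd` does not grow from `p` to `p'`. For the third, the height above `cd` is convex
along the chain and vanishes at `c`, so from `p` to `p'` it shrinks at least by the factor `(x c - x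
p') / (x c - x p)`. -/
theorem IsConvexChain.of_not_ratioLE {N : ℕ} {x y : ℕ → ℝ} (h : IsConvexChain N x y)
    {p a b p' c d : ℕ} (hpa : p < a) (hab : a < b) (hbp : b < p') (hpc : p' < c) (hcd : c < d)
    (hd : d < N) (hbad : ¬ RatioLE x y a b c d p p') :
    heightAbove x y a b p' < heightAbove x y c d p' ∧
    heightAbove x y a b p' < heightAbove x y a b p ∧
    heightAbove x y a b p' <
      (chordSlope x y a b - chordSlope x y p a) * (x c - x p') := by
  rw [RatioLE, not_le] at hbad
  have e1 := h.height_pos_of_lt hpa hab (by omega)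
  have e2 := h.height_pos_of_gt hab hbp (by omega)
  have e3 := h.height_pos_of_lt hpc hcd hd
  have e4 := h.height_pos_of_lt (p := p) (by omega) hcd hd
  have e5 := h.height_le_of_le hab (by omega : b ≤ c) hcd hd (by omega : p ≤ b)
  have e6 := h.height_anti hcd hd (by omega : p ≤ p') hpc.le
  refine ⟨by nlinarith, by nlinarith, ?_⟩
  have hcp := sub_pos.2 (h.lt (by omega : p < c) (by omega))
  have hcp' := sub_pos.2 (h.lt hpc (by omega))
  have hap := sub_pos.2 (h.lt hpa (by omega))
  have hca := sub_pos.2 (h.lt (by omega : a < c) (by omega))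
  have hs := sub_pos.2 (h.slope_lt hpa hab (by omega))
  -- convexity along the chain: `e3 / (c - p') ≤ e4 / (c - p)`
  have key : heightAbove x y c d p' * (x c - x p) ≤ heightAbove x y c d p * (x c - x p') := by
    rw [h.height_of_lt hpc (by omega), h.height_of_lt (by omega : p < c) (by omega)]
    have h1 := h.slope_lt (by omega : p < p') hpc (by omega)
    have h2 := h.slope_mul (by omega : p < p') (by omega)
    have h3 := h.slope_mul hpc (by omega)
    have h4 := h.slope_mul (by omega : p < c) (by omega)
    have hpp := sub_pos.2 (h.lt (by omega : p < p') (by omega))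
    have : chordSlope x y p c ≤ chordSlope x y p' c := by
      by_contra hcon
      rw [not_le] at hcon
      nlinarith
    have := mul_le_mul_of_nonneg_right this (mul_pos hcp hcp').le
    linarith
  have h5 : heightAbove x y a b p' * heightAbove x y c d p * (x c - x p)
      < heightAbove x y a b p * (heightAbove x y c d p * (x c - x p')) := by
    calc _ < heightAbove x y a b p * heightAbove x y c d p' * (x c - x p) := by
          have := mul_lt_mul_of_pos_right hbad hcp
          linarith
      _ ≤ _ := by
          have := mul_le_mul_of_nonneg_left key e1.le
          linarith
  have h6 : heightAbove x y a b p' * (x c - x p) < heightAbove x y a b p * (x c - x p') := by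
    have : 0 < heightAbove x y c d p *
        (heightAbove x y a b p * (x c - x p') - heightAbove x y a b p' * (x c - x p)) := by
      linarith
    have := (mul_pos_iff_of_pos_left e4).1 this
    linarith
  rw [h.height_of_lt hpa (by omega)] at h6
  have h7 : (chordSlope x y a b - chordSlope x y p a) * (x a - x p) * (x c - x p')
      ≤ (chordSlope x y a b - chordSlope x y p a) * (x c - x p') * (x c - x p) := by
    have := mul_le_mul_of_nonneg_left (by linarith : x a - x p ≤ x c - x p)
      (mul_pos hs hcp').le
    linarith
  exact lt_of_mul_lt_mul_right (h6.trans_le h7) hcp.le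

/-- A long chain cannot be uniformly bad. -/
theorem IsConvexChain.exists_ratioLE {x y : ℕ → ℝ} (h : IsConvexChain 13 x y) :
    ∃ p a b p' c d, p < a ∧ a < b ∧ b < p' ∧ p' < c ∧ c < d ∧ d < 13 ∧
      RatioLE x y a b c d p p' := by
  by_contra hcon
  push Not at hcon
  have h2 := (h.of_not_ratioLE (p := 0) (a := 1) (b := 2) (p' := 6) (c := 7) (d := 8)
    (by omega) (by omega) (by omega) (by omega) (by omega) (by omega)
    (hcon _ _ _ _ _ _ (by omega) (by omega) (by omega) (by omega) (by omega) (by omega))).1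
  have h1 := (h.of_not_ratioLE (p := 4) (a := 5) (b := 6) (p' := 10) (c := 11) (d := 12)
    (by omega) (by omega) (by omega) (by omega) (by omega) (by omega)
    (hcon _ _ _ _ _ _ (by omega) (by omega) (by omega) (by omega) (by omega) (by omega))).2.1
  have h3 := (h.of_not_ratioLE (p := 2) (a := 3) (b := 4) (p' := 8) (c := 9) (d := 10)
    (by omega) (by omega) (by omega) (by omega) (by omega) (by omega)
    (hcon _ _ _ _ _ _ (by omega) (by omega) (by omega) (by omega) (by omega) (by omega))).2.2
  set t0 := chordSlope x y 1 2
  set t1 := chordSlope x y 3 4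
  set t2 := chordSlope x y 5 6
  set t3 := chordSlope x y 7 8
  have s01 : t0 < t1 := (h.slope_lt (by omega : 1 < 2) (by omega : 2 < 3) (by omega)).trans
    (h.slope_lt (by omega : 2 < 3) (by omega : 3 < 4) (by omega))
  have s12 : t1 < t2 := (h.slope_lt (by omega : 3 < 4) (by omega : 4 < 5) (by omega)).trans
    (h.slope_lt (by omega : 4 < 5) (by omega : 5 < 6) (by omega))
  have s23 : t2 < t3 := (h.slope_lt (by omega : 5 < 6) (by omega : 6 < 7) (by omega)).trans
    (h.slope_lt (by omega : 6 < 7) (by omega : 7 < 8) (by omega))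
  have x12 := h.lt (by omega : 4 < 6) (by omega)
  have x23 := h.lt (by omega : 6 < 8) (by omega)
  have x34 := h.lt (by omega : 8 < 10) (by omega)
  -- With slope increments `s₁, s₂, s₃` and abscissa gaps `X₁, X₂, X₃` (between points 4, 6, 8, 10),
  -- the three bad tuples give `s₁X₁ < s₃X₂`, `s₃X₃ < s₂X₁`, `s₂X₂ < s₁X₃`. Both sides multiply to
  -- the same product.
  have A1 : (t1 - t0) * (x 6 - x 4) < (t3 - t2) * (x 8 - x 6) := by
    have l1 := h.height_add_le_of_ge (p := 6) (by omega : 1 < 2) (by omega : 2 ≤ 3)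
      (by omega : 3 < 4) (by omega)
    have l2 := h.height_nonneg (p := 6) (by omega : 3 < 4) (by omega) (by omega) (by omega)
    have l3 := h.lt (by omega : 3 < 4) (by omega)
    have l4 := h.slope_lt (by omega : 5 < 6) (by omega : 6 < 7) (by omega)
    have l5 := h.lt (by omega : 7 < 8) (by omega)
    rw [h.height_of_lt (by omega : 6 < 7) (by omega)] at h2
    have l6 := h.lt (by omega : 6 < 7) (by omega)
    have l7 := mul_le_mul (by linarith : t3 - chordSlope x y 6 7 ≤ t3 - t2)
      (by linarith : x 7 - x 6 ≤ x 8 - x 6) (by linarith) (by linarith)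
    have l8 := mul_le_mul_of_nonneg_left (by linarith : x 6 - x 4 ≤ x 6 - x 3)
      (by linarith : 0 ≤ t1 - t0)
    linarith
  have A2 : (t3 - t2) * (x 10 - x 8) < (t2 - t1) * (x 6 - x 4) := by
    have l1 := h.height_add_le_of_ge (p := 10) (by omega : 5 < 6) (by omega : 6 ≤ 7)
      (by omega : 7 < 8) (by omega)
    have l2 := h.height_nonneg (p := 10) (by omega : 7 < 8) (by omega) (by omega) (by omega)
    have l3 := h.lt (by omega : 7 < 8) (by omega)
    have l4 := h.slope_lt (by omega : 3 < 4) (by omega : 4 < 5) (by omega)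
    have l5 := h.lt (by omega : 5 < 6) (by omega)
    rw [h.height_of_lt (by omega : 4 < 5) (by omega)] at h1
    have l6 := h.lt (by omega : 4 < 5) (by omega)
    have l7 := mul_le_mul (by linarith : t2 - chordSlope x y 4 5 ≤ t2 - t1)
      (by linarith : x 5 - x 4 ≤ x 6 - x 4) (by linarith) (by linarith)
    have l8 := mul_le_mul_of_nonneg_left (by linarith : x 10 - x 8 ≤ x 10 - x 7)
      (by linarith : 0 ≤ t3 - t2)
    linarith
  have A3 : (t2 - t1) * (x 8 - x 6) < (t1 - t0) * (x 10 - x 8) := by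
    have l1 := h.height_add_le_of_ge (p := 8) (by omega : 3 < 4) (by omega : 4 ≤ 5)
      (by omega : 5 < 6) (by omega)
    have l2 := h.height_nonneg (p := 8) (by omega : 5 < 6) (by omega) (by omega) (by omega)
    have l3 := h.lt (by omega : 5 < 6) (by omega)
    have l4 := h.slope_lt (by omega : 1 < 2) (by omega : 2 < 3) (by omega)
    have l5 := h.lt (by omega : 9 < 10) (by omega)
    have l6 := h.lt (by omega : 8 < 9) (by omega)
    have l7 := mul_le_mul (by linarith : t1 - chordSlope x y 2 3 ≤ t1 - t0)
      (by linarith : x 9 - x 8 ≤ x 10 - x 8) (by linarith) (by linarith)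
    have l8 := mul_le_mul_of_nonneg_left (by linarith : x 8 - x 6 ≤ x 8 - x 5)
      (by linarith : 0 ≤ t2 - t1)
    linarith
  have p1 := mul_pos (sub_pos.2 s01) (sub_pos.2 x12)
  have p2 := mul_pos (sub_pos.2 s23) (sub_pos.2 x34)
  have p3 := mul_pos (sub_pos.2 s12) (sub_pos.2 x23)
  have B1 := mul_lt_mul'' A1 A2 p1.le p2.le
  have B2 := mul_lt_mul'' B1 A3 (mul_pos p1 p2).le p3.le
  linarith

/-! ### Ramsey's theorem for tuples, with an explicit bound. -/

theorem exists_fiber_card_le {α β : Type*} [Fintype β] [Nonempty β] [DecidableEq α]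
    (R : Finset α) (g : α → β) (n : ℕ) (hn : Fintype.card β * n ≤ R.card) :
    ∃ R' ⊆ R, n ≤ R'.card ∧ ∃ b, ∀ z ∈ R', g z = b := by
  classical
  obtain ⟨b, -, hb⟩ := Finset.exists_le_card_fiber_of_mul_le_card_of_maps_to
    (s := R) (t := Finset.univ) (f := g) (n := n) (fun _ _ => Finset.mem_univ _)
    Finset.univ_nonempty (by simpa using hn)
  exact ⟨_, Finset.filter_subset _ _, hb, b, fun z hz => (Finset.mem_filter.1 hz).2⟩

/-- The last entry of a long increasing tuple does not affect its colour, on a large subset. -/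
theorem exists_endHomogeneous {C : Type*} [Fintype C] [Nonempty C] (r M : ℕ) (hr : 0 < r)
    (χ : (Fin r → ℕ) → ℕ → C) (S : Finset ℕ)
    (hS : 2 ^ M * Fintype.card C ^ M ^ (r + 1) ≤ S.card) :
    ∃ T ⊆ S, T.card = M ∧ ∃ ψ : (Fin r → ℕ) → C, ∀ v : Fin r → ℕ, StrictMono v →
      (∀ i, v i ∈ T) → ∀ z ∈ T, (∀ i, v i < z) → χ v z = ψ v := by
  classical
  have hκ : 0 < Fintype.card C := Fintype.card_pos
  -- Erdős–Rado argument: `D` holds the points already chosen, `R` is a reservoir above them. The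
  -- least element of `R` moves to `D`, and the rest of `R` is thinned to points that give the same
  -- colour to every `r`-tuple from `D`. There are at most `κ ^ M ^ r` colour patterns; the extra
  -- factor 2 pays for the moved point.
  have step : ∀ q ≤ M, ∃ D ⊆ S, ∃ R ⊆ S, (∀ a ∈ D, ∀ b ∈ R, a < b) ∧ D.card = q ∧
      (2 * Fintype.card C ^ M ^ r) ^ (M - q) ≤ R.card ∧
      ∀ v : Fin r → ℕ, (∀ i, v i ∈ D) → ∃ c, ∀ z, (z ∈ D ∨ z ∈ R) → (∀ i, v i < z) →
        χ v z = c := by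
    intro q
    induction q with
    | zero =>
      intro _
      refine ⟨∅, by simp, S, subset_rfl, by simp, rfl, ?_, fun v hv => ?_⟩
      · rw [Nat.sub_zero, mul_pow, ← pow_mul, ← pow_succ]; exact hS
      · exact absurd (hv ⟨0, hr⟩) (by simp)
    | succ q ih =>
      intro hq
      obtain ⟨D, hDS, R, hRS, hDR, hDc, hRc, hcol⟩ := ih (by omega)
      have e1 : M - q = (M - (q + 1)) + 1 := by omega
      set B := Fintype.card C ^ M ^ r with hB
      have hB0 : 0 < B := pow_pos hκ _
      have hP : 0 < (2 * B) ^ (M - (q + 1)) := by positivity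
      rw [e1, pow_succ] at hRc
      have hRne : R.Nonempty := by
        rw [← Finset.card_pos]
        exact lt_of_lt_of_le (by positivity) hRc
      let x := R.min' hRne
      have hxR : x ∈ R := R.min'_mem hRne
      have hxD : x ∉ D := fun hx => lt_irrefl _ (hDR x hx x hxR)
      let D' := insert x D
      have hD'c : D'.card = q + 1 := by rw [Finset.card_insert_of_notMem hxD, hDc]
      let g : ℕ → ((Fin r → D') → C) := fun z u => χ (fun i => (u i : ℕ)) z
      have hcard : Fintype.card ((Fin r → D') → C) ≤ B := by
        rw [Fintype.card_fun, Fintype.card_fun, Fintype.card_coe, Fintype.card_fin, hD'c]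
        exact Nat.pow_le_pow_right hκ (Nat.pow_le_pow_left hq _)
      obtain ⟨R', hR', hR'c, b, hb⟩ := exists_fiber_card_le (R.erase x) g
        ((2 * B) ^ (M - (q + 1))) (by
          rw [Finset.card_erase_of_mem hxR]
          have h1 := Nat.mul_le_mul_right ((2 * B) ^ (M - (q + 1))) hcard
          have h2 : 0 < B * (2 * B) ^ (M - (q + 1)) := by positivity
          have h3 : (2 * B) ^ (M - (q + 1)) * (2 * B) = 2 * (B * (2 * B) ^ (M - (q + 1))) := by
            ring
          omega)
      have hR'R : R' ⊆ R := hR'.trans (Finset.erase_subset _ _)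
      have hxR' : ∀ z ∈ R', x < z := fun z hz =>
        lt_of_le_of_ne (R.min'_le z (hR'R hz)) (Finset.ne_of_mem_erase (hR' hz)).symm
      refine ⟨D', Finset.insert_subset (hRS hxR) hDS, R', hR'R.trans hRS, ?_, hD'c, hR'c, ?_⟩
      · intro a ha z hz
        rcases Finset.mem_insert.1 ha with rfl | ha
        · exact hxR' z hz
        · exact hDR a ha z (hR'R hz)
      · intro v hv
        by_cases hvD : ∀ i, v i ∈ D
        · obtain ⟨c, hc⟩ := hcol v hvD
          refine ⟨c, fun z hz hvz => hc z ?_ hvz⟩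
          rcases hz with hz | hz
          · rcases Finset.mem_insert.1 hz with rfl | hz
            · exact Or.inr hxR
            · exact Or.inl hz
          · exact Or.inr (hR'R hz)
        · push Not at hvD
          obtain ⟨i, hi⟩ := hvD
          have hvi : v i = x := (Finset.mem_insert.1 (hv i)).resolve_right hi
          refine ⟨b fun i => ⟨v i, hv i⟩, fun z hz hvz => ?_⟩
          have hxz : x < z := hvi ▸ hvz i
          have hzR' : z ∈ R' := by
            refine hz.resolve_left fun hzD => ?_
            rcases Finset.mem_insert.1 hzD with rfl | hzD
            · exact lt_irrefl _ hxz
            · exact lt_asymm hxz (hDR z hzD x hxR)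
          rw [← hb z hzR']
  obtain ⟨D, hDS, R, -, -, hDc, -, hcol⟩ := step M le_rfl
  refine ⟨D, hDS, hDc, fun v => if hv : ∀ i, v i ∈ D then (hcol v hv).choose else
    Classical.arbitrary C, fun v _ hv z hz hvz => ?_⟩
  beta_reduce
  rw [dif_pos hv]
  exact (hcol v hv).choose_spec z (Or.inl hz) hvz

/-- An upper bound for the Ramsey number of `(r + 1)`-tuples with `κ` colours. -/
def ramseyBound (κ n : ℕ) : ℕ → ℕ
  | 0 => κ * n
  | r + 1 => 2 ^ ramseyBound κ n r * κ ^ ramseyBound κ n r ^ (r + 2)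

/-- On an end-homogeneous set the last coordinate can be dropped, leaving a colouring of shorter
tuples; `ramseyBound` makes that set just large enough for the induction hypothesis. -/
theorem exists_homogeneous {C : Type*} [Fintype C] [Nonempty C] (n r : ℕ) :
    ∀ (χ : (Fin (r + 1) → ℕ) → C) (S : Finset ℕ), ramseyBound (Fintype.card C) n r ≤ S.card →
    ∃ T ⊆ S, T.card = n ∧ ∃ c, ∀ v : Fin (r + 1) → ℕ, StrictMono v → (∀ i, v i ∈ T) →
      χ v = c := by
  induction r with
  | zero =>
    intro χ S hS
    obtain ⟨R, hRS, hRc, c, hc⟩ := exists_fiber_card_le S (fun z => χ fun _ => z) n hS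
    obtain ⟨T, hTR, hTc⟩ := Finset.exists_subset_card_eq hRc
    refine ⟨T, hTR.trans hRS, hTc, c, fun v _ hv => ?_⟩
    rw [← hc (v 0) (hTR (hv 0))]
    congr 1
    ext i
    rw [Fin.fin_one_eq_zero i]
  | succ r ih =>
    intro χ S hS
    obtain ⟨T, hTS, hTc, ψ, hψ⟩ := exists_endHomogeneous (r + 1) (ramseyBound (Fintype.card C) n r)
      (Nat.succ_pos r) (fun v z => χ (Fin.snoc v z)) S hS
    obtain ⟨U, hUT, hUc, c, hc⟩ := ih ψ T hTc.ge
    refine ⟨U, hUT.trans hTS, hUc, c, fun v hv hvU => ?_⟩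
    have h1 := hψ (fun i => v i.castSucc) (fun i j hij => hv hij) (fun i => hUT (hvU _))
      (v (Fin.last _)) (hUT (hvU _)) (fun i => hv (Fin.castSucc_lt_last i))
    have h2 : (Fin.snoc (fun i : Fin (r + 1) => v i.castSucc) (v (Fin.last _)) :
        Fin (r + 2) → ℕ) = v := Fin.snoc_init_self v
    rw [h2] at h1
    rw [h1]
    exact hc _ (fun i j hij => hv hij) fun i => hvU _

theorem exists_homogeneous_subsequence {C : Type*} [Fintype C] [Nonempty C] (n r N : ℕ)
    (hN : ramseyBound (Fintype.card C) n r ≤ N) (χ : (Fin (r + 1) → ℕ) → C) :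
    ∃ φ : ℕ → ℕ, (∀ {a b}, a < b → b < n → φ a < φ b) ∧ (∀ a < n, φ a < N) ∧
      ∃ c, ∀ v : Fin (r + 1) → ℕ, StrictMono v → (∀ i, v i < n) → χ (fun i => φ (v i)) = c := by
  obtain ⟨T, hT, hTc, c, hc⟩ := exists_homogeneous n r χ (Finset.range N) (by simpa using hN)
  let e := T.orderEmbOfFin hTc
  refine ⟨fun a => if h : a < n then e ⟨a, h⟩ else 0, ?_, ?_, c, ?_⟩
  · intro a b hab hb
    beta_reduce
    rw [dif_pos hb, dif_pos (hab.trans hb)]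
    exact e.strictMono hab
  · intro a ha
    beta_reduce
    rw [dif_pos ha]
    exact Finset.mem_range.1 (hT (T.orderEmbOfFin_mem hTc _))
  · intro v hv hvn
    simp only [hvn, dif_pos]
    exact hc _ (fun i j hij => e.strictMono (hv hij)) fun i => T.orderEmbOfFin_mem hTc _

/-! ### Tame chains. -/

theorem IsConvexChain.comp {N n : ℕ} {x y : ℕ → ℝ} (h : IsConvexChain N x y) {φ : ℕ → ℕ}
    (hφ : ∀ {a b}, a < b → b < n → φ a < φ b) (hφN : ∀ a < n, φ a < N) :
    IsConvexChain n (fun a => x (φ a)) (fun a => y (φ a)) where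
  lt hab hb := h.lt (hφ hab hb) (hφN _ hb)
  convex hab hbc hc := h.convex (hφ hab (hbc.trans hc)) (hφ hbc hc) (hφN _ hc)

theorem IsConvexChain.mono {N n : ℕ} {x y : ℕ → ℝ} (h : IsConvexChain N x y) (hn : n ≤ N) :
    IsConvexChain n x y :=
  h.comp (φ := id) (fun hab _ => hab) fun _ ha => ha.trans_le hn

/-- The mirror image of a chain. -/
theorem IsConvexChain.reverse {n : ℕ} {x y : ℕ → ℝ} (h : IsConvexChain (n + 1) x y) :
    IsConvexChain (n + 1) (fun a => -x (n - a)) (fun a => y (n - a)) where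
  lt {a b} hab hb := neg_lt_neg (h.lt (by omega) (by omega))
  convex {a b c} hab hbc hc := by
    have := h.convex (a := n - c) (b := n - b) (c := n - a) (by omega) (by omega) (by omega)
    linarith

theorem IsConvexChain.height_swap {N : ℕ} {x y : ℕ → ℝ} (h : IsConvexChain N x y) {a b : ℕ}
    (p : ℕ) (hab : a < b) (hb : b < N) : heightAbove x y b a p = heightAbove x y a b p := by
  have h1 := h.slope_mul hab hb
  have h2 : chordSlope x y b a = chordSlope x y a b := by
    rw [chordSlope, chordSlope, ← neg_sub (y b), ← neg_sub (x b), neg_div_neg_eq]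
  rw [heightAbove, heightAbove, h2]
  linarith

theorem IsConvexChain.height_reverse {n : ℕ} {x y : ℕ → ℝ} (h : IsConvexChain (n + 1) x y)
    {a b : ℕ} (p : ℕ) (hab : a < b) (hb : b < n + 1) :
    heightAbove (fun a => -x (n - a)) (fun a => y (n - a)) a b p =
      heightAbove x y (n - b) (n - a) (n - p) := by
  rw [← h.height_swap _ (by omega : n - b < n - a) (by omega)]
  have h2 : chordSlope (fun a => -x (n - a)) (fun a => y (n - a)) a b =
      - chordSlope x y (n - a) (n - b) := by
    simp only [chordSlope]
    rw [← div_neg]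
    congr 1
    ring
  rw [heightAbove, h2, heightAbove]
  ring

/-- The mirrored form of `IsConvexChain.exists_ratioLE`. -/
theorem IsConvexChain.exists_ratioLE' {x y : ℕ → ℝ} (h : IsConvexChain 13 x y) :
    ∃ a b p c d p', a < b ∧ b < p ∧ p < c ∧ c < d ∧ d < p' ∧ p' < 13 ∧
      RatioLE x y a b c d p p' := by
  obtain ⟨p, a, b, p', c, d, h1, h2, h3, h4, h5, h6, hr⟩ :=
    IsConvexChain.exists_ratioLE (h.reverse (n := 12))
  refine ⟨12 - d, 12 - c, 12 - p', 12 - b, 12 - a, 12 - p, by omega, by omega, by omega, by omega,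
    by omega, by omega, ?_⟩
  rw [RatioLE, h.height_reverse (n := 12) _ h2 (by omega), h.height_reverse (n := 12) _ h5 h6,
    h.height_reverse (n := 12) _ h2 (by omega), h.height_reverse (n := 12) _ h5 h6] at hr
  rw [RatioLE]
  linarith

/-- The heights above an earlier line relative to a later one compare well. -/
structure IsTame (n : ℕ) (x y : ℕ → ℝ) : Prop extends IsConvexChain n x y where
  ratioLE {p a b p' c d : ℕ} : p < a → a < b → b < p' → p' < c → c < d → d < n →
    RatioLE x y a b c d p p'
  ratioLE' {a b p c d p' : ℕ} : a < b → b < p → p < c → c < d → d < p' → p' < n →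
    RatioLE x y a b c d p p'

theorem strictMono_vec6 {p a b q c d : ℕ} (h1 : p < a) (h2 : a < b) (h3 : b < q) (h4 : q < c)
    (h5 : c < d) : StrictMono ![p, a, b, q, c, d] := by
  rw [Fin.strictMono_iff_lt_succ]
  intro i
  fin_cases i <;> simpa

theorem vec6_lt {p a b q c d n : ℕ} (h1 : p < a) (h2 : a < b) (h3 : b < q) (h4 : q < c)
    (h5 : c < d) (h6 : d < n) (i : Fin 6) : ![p, a, b, q, c, d] i < n := by
  refine lt_of_le_of_lt ((strictMono_vec6 h1 h2 h3 h4 h5).monotone (Fin.le_last i)) h6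

/-- Each 6-tuple is coloured by the truth of the two ratio comparisons. On a homogeneous subchain
the colour is constant, and its first 13 points contain one good tuple for each comparison, so every
tuple is good. -/
theorem IsConvexChain.exists_isTame {N n : ℕ} {x y : ℕ → ℝ} (h : IsConvexChain N x y)
    (hn : 13 ≤ n) (hN : ramseyBound 4 n 5 ≤ N) :
    ∃ φ : ℕ → ℕ, (∀ {a b}, a < b → b < n → φ a < φ b) ∧ (∀ a < n, φ a < N) ∧
      IsTame n (fun a => x (φ a)) (fun a => y (φ a)) := by
  classical
  obtain ⟨φ, hφ, hφN, c, hc⟩ := exists_homogeneous_subsequence (C := Bool × Bool) n 5 N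
    (by simpa using hN) fun v =>
      (decide (RatioLE x y (v 1) (v 2) (v 4) (v 5) (v 0) (v 3)),
       decide (RatioLE x y (v 0) (v 1) (v 3) (v 4) (v 2) (v 5)))
  have hch := h.comp hφ hφN
  refine ⟨φ, hφ, hφN, hch, ?_, ?_⟩
  · obtain ⟨p, a, b, q, e, d, h1, h2, h3, h4, h5, h6, hr⟩ := (hch.mono hn).exists_ratioLE
    have k1 := hc _ (strictMono_vec6 h1 h2 h3 h4 h5)
      (vec6_lt h1 h2 h3 h4 h5 (h6.trans_le hn))
    have k1' : c.1 = true := by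
      rw [← k1]
      exact decide_eq_true hr
    intro p a b q e d h1 h2 h3 h4 h5 h6
    have k2 := hc _ (strictMono_vec6 h1 h2 h3 h4 h5) (vec6_lt h1 h2 h3 h4 h5 h6)
    rw [← k2] at k1'
    exact of_decide_eq_true k1'
  · obtain ⟨p, a, b, q, e, d, h1, h2, h3, h4, h5, h6, hr⟩ := (hch.mono hn).exists_ratioLE'
    have k1 := hc _ (strictMono_vec6 h1 h2 h3 h4 h5)
      (vec6_lt h1 h2 h3 h4 h5 (h6.trans_le hn))
    have k1' : c.2 = true := by
      rw [← k1]
      exact decide_eq_true hr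
    intro p a b q e d h1 h2 h3 h4 h5 h6
    have k2 := hc _ (strictMono_vec6 h1 h2 h3 h4 h5) (vec6_lt h1 h2 h3 h4 h5 h6)
    rw [← k2] at k1'
    exact of_decide_eq_true k1'

/-- Two edges of a tame chain are compared by a single ratio on the two sides. -/
theorem IsTame.exists_ratio {n : ℕ} {x y : ℕ → ℝ} (h : IsTame n x y) {a m c : ℕ}
    (ha : 0 < a ∨ a + 2 < m) (ham : a + 1 < m) (hmc : m ≤ c) (hc : c + 1 < n) :
    ∃ r : ℝ, 0 < r ∧
      (∀ p < m, heightAbove x y a (a + 1) p ≤ r * heightAbove x y c (c + 1) p) ∧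
      ∀ p, m ≤ p → p < n → r * heightAbove x y c (c + 1) p ≤ heightAbove x y a (a + 1) p := by
  have hch := h.toIsConvexChain
  have hpos : ∀ p < m, 0 < heightAbove x y c (c + 1) p := fun p hp =>
    hch.height_pos_of_lt (by omega) (by omega) hc
  -- The least constant that works left of `m` is the maximal ratio there. It also works on the
  -- right provided the ratio does not drop from the maximizer `p₀` to any `p' ≥ m`. The hypothesis
  -- `ha` supplies a point left of `m` off the edge `a`, so the maximum is positive.
  obtain ⟨p₀, hp₀, hmax⟩ := (Finset.range m).exists_max_image
    (fun p => heightAbove x y a (a + 1) p / heightAbove x y c (c + 1) p) ⟨0, by simp; omega⟩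
  rw [Finset.mem_range] at hp₀
  refine ⟨heightAbove x y a (a + 1) p₀ / heightAbove x y c (c + 1) p₀, ?_, fun p hp => ?_,
    fun p' hmp' hp' => ?_⟩
  · rcases ha with ha | ha
    · exact lt_of_lt_of_le (div_pos (hch.height_pos_of_lt ha (by omega) (by omega))
        (hpos 0 (by omega))) (hmax 0 (by simp; omega))
    · exact lt_of_lt_of_le (div_pos (hch.height_pos_of_gt (by omega) (by omega) (by omega))
        (hpos (a + 2) ha)) (hmax (a + 2) (by simpa using ha))
  · have := hmax p (by simpa using hp)
    rwa [div_le_iff₀ (hpos p hp)] at this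
  · rw [div_mul_eq_mul_div, div_le_iff₀ (hpos _ hp₀), mul_comm (heightAbove x y a (a + 1) p')]
    have n1 := hch.height_succ_nonneg (a := a) (p := p₀) (by omega) (by omega)
    have n2 := hch.height_succ_nonneg (a := a) (p := p') (by omega) (by omega)
    have n3 := (hpos p₀ hp₀).le
    have n4 := hch.height_succ_nonneg (a := c) (p := p') (by omega) (by omega)
    have zl : heightAbove x y a (a + 1) p₀ = 0 → heightAbove x y a (a + 1) p₀ *
        heightAbove x y c (c + 1) p' ≤ heightAbove x y c (c + 1) p₀ *
        heightAbove x y a (a + 1) p' := fun e => by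
      rw [e, zero_mul]; exact mul_nonneg n3 n2
    have zr : heightAbove x y c (c + 1) p' = 0 → heightAbove x y a (a + 1) p₀ *
        heightAbove x y c (c + 1) p' ≤ heightAbove x y c (c + 1) p₀ *
        heightAbove x y a (a + 1) p' := fun e => by
      rw [e, mul_zero]; exact mul_nonneg n3 n2
    rcases lt_trichotomy p₀ a with hpa | rfl | hpa
    · rcases lt_trichotomy p' c with hpc | rfl | hpc
      · exact h.ratioLE hpa (Nat.lt_succ_self a) (by omega) hpc (Nat.lt_succ_self c) hc
      · exact zr (heightAbove_left _ _ _ _)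
      · exact mul_le_mul
          (hch.height_le_of_le (Nat.lt_succ_self a) (by omega) (Nat.lt_succ_self c) hc (by omega))
          (hch.height_le_of_ge (Nat.lt_succ_self a) (by omega) (Nat.lt_succ_self c) hc hpc.le hp')
          n4 n3
    · exact zl (heightAbove_left _ _ _ _)
    · rcases (Nat.succ_le_of_lt hpa).eq_or_lt with rfl | hpa
      · exact zl (hch.height_right (Nat.lt_succ_self a) (by omega))
      rcases lt_trichotomy p' c with hpc | rfl | hpc
      · rw [mul_comm]
        exact mul_le_mul
          (hch.height_anti (Nat.lt_succ_self c) hc (by omega) hpc.le)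
          (hch.height_mono (Nat.lt_succ_self a) (by omega) (by omega) hp') n1 n3
      · exact zr (heightAbove_left _ _ _ _)
      · rcases (Nat.succ_le_of_lt hpc).eq_or_lt with rfl | hpc
        · exact zr (hch.height_right (Nat.lt_succ_self c) hc)
        · exact h.ratioLE' (Nat.lt_succ_self a) hpa (by omega) (Nat.lt_succ_self c) hpc hp'

/-! ### Cones of nonnegative affine functions on a chain. -/

theorem smul_mem_of_nonneg {ι : Type*} (K : Submodule ℝ≥0 (ι → ℝ)) {f : ι → ℝ} (hf : f ∈ K)
    {c : ℝ} (hc : 0 ≤ c) : (fun p => c * f p) ∈ K :=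
  K.smul_mem ⟨c, hc⟩ hf

/-- An affine function that is nonnegative on a chain is a nonnegative combination of the heights
above the edges, the distances to the extreme abscissas, and the depth below the long chord. -/
theorem IsConvexChain.affine_mem {N : ℕ} {x y : ℕ → ℝ} (h : IsConvexChain (N + 2) x y)
    (K : Submodule ℝ≥0 (Fin (N + 2) → ℝ))
    (hedge : ∀ s, s + 1 < N + 2 → (fun p : Fin (N + 2) => heightAbove x y s (s + 1) p) ∈ K)
    (hleft : (fun p : Fin (N + 2) => x p - x 0) ∈ K)
    (hright : (fun p : Fin (N + 2) => x (N + 1) - x p) ∈ K)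
    (hchord : (fun p : Fin (N + 2) => -heightAbove x y 0 (N + 1) p) ∈ K) (α β γ : ℝ)
    (hg : ∀ p : Fin (N + 2), 0 ≤ α + β * x p + γ * y p) :
    (fun p : Fin (N + 2) => α + β * x p + γ * y p) ∈ K := by
  have hX : 0 < x (N + 1) - x 0 := sub_pos.2 (h.lt (by omega) (by omega))
  have lin : ∀ u v : ℝ, 0 ≤ u + v * x 0 → 0 ≤ u + v * x (N + 1) →
      (fun p : Fin (N + 2) => u + v * x p) ∈ K := by
    intro u v h0 h1
    have := K.add_mem (smul_mem_of_nonneg K hleft (div_nonneg h1 hX.le))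
      (smul_mem_of_nonneg K hright (div_nonneg h0 hX.le))
    convert this using 1
    ext p
    simp only [Pi.add_apply]
    field_simp
    ring
  -- For `γ ≤ 0`, subtracting a multiple of the depth below the long chord leaves a function of `x`
  -- alone, nonnegative at both ends. For `γ > 0`, subtract the minimum, attained at a vertex `s`;
  -- the rest measures height above a supporting line at `s`, which lies between the two adjacent
  -- edges, or beyond the only one if `s` is an end.
  rcases le_or_gt γ 0 with hγ | hγ
  · have h1 := smul_mem_of_nonneg K hchord (neg_nonneg.2 hγ)
    have e0 := heightAbove_left x y 0 (N + 1)
    have e1 := h.height_right (by omega : 0 < N + 1) (by omega)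
    have h2 := lin (α + γ * (y 0 - chordSlope x y 0 (N + 1) * x 0))
      (β + γ * chordSlope x y 0 (N + 1)) (by
        have := hg 0
        simp only [heightAbove, Fin.val_zero] at *
        linarith) (by
        have := hg (Fin.last _)
        have e2 := congrArg (fun t => γ * t) e1
        simp only [heightAbove, Fin.val_last] at *
        linarith)
    convert K.add_mem h1 h2 using 1
    ext p
    simp only [Pi.add_apply, heightAbove]
    ring
  · obtain ⟨s, -, hs⟩ := Finset.univ.exists_min_image
      (fun p : Fin (N + 2) => α + β * x p + γ * y p) ⟨0, Finset.mem_univ _⟩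
    have hs' : ∀ p < N + 2, α + β * x s + γ * y s ≤ α + β * x p + γ * y p := fun p hp =>
      hs ⟨p, hp⟩ (Finset.mem_univ _)
    have hconst := lin (α + β * x s + γ * y s) 0 (by simpa using hg s) (by simpa using hg s)
    suffices hsup : (fun p : Fin (N + 2) => γ * (y p - y s) + β * (x p - x s)) ∈ K by
      convert K.add_mem hconst hsup using 1
      ext p
      simp only [Pi.add_apply]
      ring
    have left : (s : ℕ) ≠ N + 1 → 0 ≤ γ * chordSlope x y s (s + 1) + β := by
      intro hsN
      have h1 := hs' (s + 1) (by omega)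
      have h2 := sub_pos.2 (h.lt (by omega : (s : ℕ) < s + 1) (by omega))
      have h3 := h.slope_mul (by omega : (s : ℕ) < s + 1) (by omega)
      refine nonneg_of_mul_nonneg_left ?_ h2
      linear_combination h1 - γ * h3
    have right : ∀ t, (s : ℕ) = t + 1 → γ * chordSlope x y t (t + 1) + β ≤ 0 := by
      intro t hst
      have h1 := hs' t (by omega)
      have h2 := sub_pos.2 (h.lt (by omega : t < t + 1) (by omega))
      have h3 := h.slope_mul (by omega : t < t + 1) (by omega)
      rw [hst] at h1
      refine nonpos_of_mul_nonpos_left ?_ h2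
      linear_combination h1 + γ * h3
    rcases Nat.eq_zero_or_eq_succ_pred (s : ℕ) with hs0 | hst
    · have h1 := left (by omega)
      rw [hs0] at h1
      convert K.add_mem (smul_mem_of_nonneg K (hedge 0 (by omega)) hγ.le)
        (smul_mem_of_nonneg K hleft h1) using 1
      ext p
      simp only [Pi.add_apply, heightAbove, hs0]
      ring
    · set t := (s : ℕ).pred
      have hst : (s : ℕ) = t + 1 := hst
      have h1 := right t hst
      have h3 := h.slope_mul (by omega : t < t + 1) (by omega)
      by_cases hsN : (s : ℕ) = N + 1
      · have htN : t = N := by omega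
        convert K.add_mem (smul_mem_of_nonneg K (hedge t (by omega)) hγ.le)
          (smul_mem_of_nonneg K hright (neg_nonneg.2 h1)) using 1
        ext p
        simp only [Pi.add_apply, heightAbove, hst, htN] at *
        linear_combination γ * h3
      · have h2 := left hsN
        rw [hst] at h2
        have h4 := sub_pos.2 (h.slope_lt (by omega : t < t + 1) (by omega : t + 1 < t + 1 + 1)
          (by omega))
        convert K.add_mem
          (smul_mem_of_nonneg K (hedge t (by omega)) (div_nonneg h2 h4.le))
          (smul_mem_of_nonneg K (hedge (t + 1) (by omega))
            (div_nonneg (neg_nonneg.2 h1) h4.le)) using 1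
        ext p
        simp only [Pi.add_apply, heightAbove, hst] at *
        rw [div_mul_eq_mul_div, div_mul_eq_mul_div, ← add_div, eq_div_iff h4.ne']
        linear_combination (γ * chordSlope x y (t + 1) (t + 1 + 1) + β) * h3

/-- Comparison of an edge with the first and the last edge of a stretch of the chain. -/
theorem IsConvexChain.height_ends_le {n : ℕ} {x y : ℕ → ℝ} (h : IsConvexChain n x y) {A B a : ℕ}
    (hAB : A + 2 ≤ B + 1) (hB : B + 1 < n) (hAa : A ≤ a) (haB : a ≤ B) :
    heightAbove x y a (a + 1) A * heightAbove x y A (A + 1) (B + 1) +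
      heightAbove x y a (a + 1) (B + 1) * heightAbove x y B (B + 1) A ≤
      heightAbove x y B (B + 1) A * heightAbove x y A (A + 1) (B + 1) := by
  have hS : 0 < chordSlope x y B (B + 1) - chordSlope x y A (A + 1) := by
    have h1 := h.slope_lt (by omega : A < A + 1) (by omega : A + 1 < B + 1) hB
    have h2 := h.slope_mul (by omega : B < B + 1) hB
    rcases (by omega : A + 1 ≤ B).eq_or_lt with e | e
    · subst e
      exact sub_pos.2 h1
    · exact sub_pos.2 ((h.slope_lt (by omega : A < A + 1) e (by omega)).trans
        (h.slope_lt e (by omega : B < B + 1) hB))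
  have hfa : chordSlope x y A (A + 1) ≤ chordSlope x y a (a + 1) := by
    rcases hAa.eq_or_lt with rfl | e
    · exact le_rfl
    · exact h.slope_le (by omega) (by omega) (by omega) (by omega)
  have hal : chordSlope x y a (a + 1) ≤ chordSlope x y B (B + 1) := by
    rcases haB.eq_or_lt with rfl | e
    · exact le_rfl
    · exact h.slope_le (by omega) (by omega) (by omega) (by omega)
  -- The weights interpolate the slope of edge `a` between the extreme slopes, so the difference of
  -- the two sides does not depend on `p`; at the point `a` its sign is visible.
  have key : ∀ p, (chordSlope x y B (B + 1) - chordSlope x y A (A + 1)) *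
      heightAbove x y a (a + 1) p ≤
      (chordSlope x y B (B + 1) - chordSlope x y a (a + 1)) * heightAbove x y A (A + 1) p +
      (chordSlope x y a (a + 1) - chordSlope x y A (A + 1)) * heightAbove x y B (B + 1) p := by
    intro p
    have n1 := mul_nonneg (sub_nonneg.2 hal)
      (h.height_succ_nonneg (a := A) (p := a) (by omega) (by omega))
    have n2 := mul_nonneg (sub_nonneg.2 hfa)
      (h.height_succ_nonneg (a := B) (p := a) (by omega) (by omega))
    simp only [heightAbove] at *
    nlinarith
  have kA := key A
  have kB := key (B + 1)
  rw [heightAbove_left, mul_zero, zero_add] at kA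
  rw [h.height_right (by omega : B < B + 1) hB, mul_zero, add_zero] at kB
  have P := h.height_succ_nonneg (a := B) (p := A) hB (by omega)
  have Q := h.height_succ_nonneg (a := A) (p := B + 1) (by omega) hB
  refine le_of_mul_le_mul_left ?_ hS
  have := add_le_add (mul_le_mul_of_nonneg_right kA Q) (mul_le_mul_of_nonneg_right kB P)
  linarith

/-- An affine function is determined by its values at two points and its `y`-coefficient. -/
theorem IsConvexChain.eq_combination {n : ℕ} {x y : ℕ → ℝ} (h : IsConvexChain n x y) {A B : ℕ}
    (hAB : A + 2 ≤ B + 1) (hB : B + 1 < n) (α β γ : ℝ) {u v : ℝ}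
    (hu : u * heightAbove x y A (A + 1) (B + 1) = α + β * x (B + 1) + γ * y (B + 1))
    (hv : v * heightAbove x y B (B + 1) A = α + β * x A + γ * y A) (p : ℕ) :
    α + β * x p + γ * y p = u * heightAbove x y A (A + 1) p + v * heightAbove x y B (B + 1) p +
      (u + v - γ) * -heightAbove x y A (B + 1) p := by
  have hX := sub_pos.2 (h.lt (by omega : A < B + 1) hB)
  have e1 := heightAbove_left x y A (A + 1)
  have e2 := heightAbove_left x y A (B + 1)
  have e3 := h.height_right (by omega : A < B + 1) hB
  have e4 := h.height_right (by omega : B < B + 1) hB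
  have zA : α + β * x A + γ * y A = u * heightAbove x y A (A + 1) A +
      v * heightAbove x y B (B + 1) A + (u + v - γ) * -heightAbove x y A (B + 1) A := by
    rw [e1, e2]; linarith
  have zB : α + β * x (B + 1) + γ * y (B + 1) = u * heightAbove x y A (A + 1) (B + 1) +
      v * heightAbove x y B (B + 1) (B + 1) +
      (u + v - γ) * -heightAbove x y A (B + 1) (B + 1) := by
    rw [e3, e4]; linarith
  refine mul_left_cancel₀ hX.ne' ?_
  simp only [heightAbove] at zA zB ⊢
  linear_combination (x (B + 1) - x p) * zA + (x p - x A) * zB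

/-- A difference of two edge heights, nonnegative at the ends of a stretch, is on this stretch a
nonnegative combination of three functions. -/
theorem IsConvexChain.indicator_mem {n : ℕ} {x y : ℕ → ℝ} (h : IsConvexChain n x y) {A B a e : ℕ}
    (hAB : A + 2 ≤ B + 1) (hB : B + 1 < n) (hAa : A ≤ a) (haB : a ≤ B)
    (he : e + 1 ≤ A ∨ B + 1 ≤ e) (hen : e + 1 < n) (I : Set (Fin n)) [DecidablePred (· ∈ I)]
    (K : Submodule ℝ≥0 (Fin n → ℝ))
    (hfirst : (fun p : Fin n => if p ∈ I then heightAbove x y A (A + 1) p else 0) ∈ K)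
    (hlast : (fun p : Fin n => if p ∈ I then heightAbove x y B (B + 1) p else 0) ∈ K)
    (hchord : (fun p : Fin n => if p ∈ I then -heightAbove x y A (B + 1) p else 0) ∈ K)
    {c c' : ℝ} (hc : 0 ≤ c) (hc' : 0 ≤ c')
    (hA : c * heightAbove x y a (a + 1) A ≤ c' * heightAbove x y e (e + 1) A)
    (hB' : c * heightAbove x y a (a + 1) (B + 1) ≤ c' * heightAbove x y e (e + 1) (B + 1)) :
    (fun p : Fin n => if p ∈ I then
      c' * heightAbove x y e (e + 1) p - c * heightAbove x y a (a + 1) p else 0) ∈ K := by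
  set P := heightAbove x y B (B + 1) A with hP
  set Q := heightAbove x y A (A + 1) (B + 1) with hQ
  have P0 : 0 < P := by
    rcases (by omega : A + 1 ≤ B).eq_or_lt with r | r
    · exact h.height_pos_of_lt (by omega) (by omega) hB
    · exact h.height_pos_of_lt (by omega) (by omega) hB
  have Q0 : 0 < Q := h.height_pos_of_gt (by omega) (by omega) hB
  set gA := c' * heightAbove x y e (e + 1) A - c * heightAbove x y a (a + 1) A with hgA
  set gB := c' * heightAbove x y e (e + 1) (B + 1) - c * heightAbove x y a (a + 1) (B + 1) with hgB
  have hgA0 : 0 ≤ gA := sub_nonneg.2 hA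
  have hgB0 : 0 ≤ gB := sub_nonneg.2 hB'
  -- This is the coefficient of the depth below the chord. It is nonnegative because the normalized
  -- end heights sum to at most 1 for an edge inside the stretch and to at least 1 for an edge
  -- outside.
  have hd : 0 ≤ gB / Q + gA / P - (c' - c) := by
    have k1 := h.height_ends_le hAB hB hAa haB
    rw [← hP, ← hQ] at k1
    have m1 := h.height_succ_nonneg (a := e) (p := A) hen (by omega)
    have m2 := h.height_succ_nonneg (a := e) (p := B + 1) hen (by omega)
    have k2 : P * Q ≤ heightAbove x y e (e + 1) A * Q + heightAbove x y e (e + 1) (B + 1) * P := by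
      rcases he with he | he
      · have := h.height_le_of_ge (by omega : e < e + 1) he (by omega : A < A + 1)
          (by omega) (by omega : A ≤ B + 1) hB
        have := mul_le_mul_of_nonneg_right this P0.le
        have := mul_nonneg m1 Q0.le
        linarith
      · have := h.height_le_of_le (by omega : B < B + 1) he (by omega : e < e + 1)
          (by omega) (by omega : A ≤ B + 1)
        have := mul_le_mul_of_nonneg_right this Q0.le
        have := mul_nonneg m2 P0.le
        linarith
    have k3 : gB / Q + gA / P - (c' - c) = (gB * P + gA * Q - (c' - c) * (P * Q)) / (P * Q) := by
      field_simp
    rw [k3]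
    refine div_nonneg ?_ (mul_pos P0 Q0).le
    have k4 := mul_le_mul_of_nonneg_left k1 hc
    have k5 := mul_le_mul_of_nonneg_left k2 hc'
    rw [hgA, hgB]
    linarith
  have mem := K.add_mem (K.add_mem (smul_mem_of_nonneg K hfirst (div_nonneg hgB0 Q0.le))
    (smul_mem_of_nonneg K hlast (div_nonneg hgA0 P0.le))) (smul_mem_of_nonneg K hchord hd)
  convert mem using 1
  ext p
  simp only [Pi.add_apply]
  split_ifs
  · have key := h.eq_combination hAB hB
      (c' * (-y e + chordSlope x y e (e + 1) * x e) - c * (-y a + chordSlope x y a (a + 1) * x a))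
      (-(c' * chordSlope x y e (e + 1)) + c * chordSlope x y a (a + 1)) (c' - c)
      (u := gB / Q) (v := gA / P)
      (by rw [← hQ, div_mul_cancel₀ _ Q0.ne', hgB]; simp only [heightAbove]; ring)
      (by rw [← hP, div_mul_cancel₀ _ P0.ne', hgA]; simp only [heightAbove]; ring) p
    rw [← key]
    simp only [heightAbove]
    ring
  · simp

/-! ### Grouping a tame chain: scalings and generators. -/

theorem mul_add_le_mul_of_lt {q i k : ℕ} (h : i < k) : q * i + q ≤ q * k := by
  rw [← Nat.mul_succ]
  exact Nat.mul_le_mul_left q h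

/-- The `j`-th edges of the groups can be scaled so that on each group its own edge is lowest. -/
theorem IsTame.exists_potential {q k : ℕ} {x y : ℕ → ℝ} (h : IsTame (q * k) x y) (hq : 3 ≤ q)
    {j : ℕ} (hj : j + 1 < q) :
    ∃ c : ℕ → ℝ, (∀ i, 0 < c i) ∧ ∀ i i' p, i < k → i' < k → q * i' ≤ p → p < q * i' + q →
      c i' * heightAbove x y (q * i' + j) (q * i' + j + 1) p ≤
        c i * heightAbove x y (q * i + j) (q * i + j + 1) p := by
  have hr : ∀ i, ∃ r : ℝ, 0 < r ∧ (i + 1 < k →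
      (∀ p < q * (i + 1), heightAbove x y (q * i + j) (q * i + j + 1) p ≤
        r * heightAbove x y (q * (i + 1) + j) (q * (i + 1) + j + 1) p) ∧
      ∀ p, q * (i + 1) ≤ p → p < q * k →
        r * heightAbove x y (q * (i + 1) + j) (q * (i + 1) + j + 1) p ≤
          heightAbove x y (q * i + j) (q * i + j + 1) p) := by
    intro i
    by_cases hi : i + 1 < k
    · have e1 := mul_add_le_mul_of_lt (q := q) hi
      have e2 : q * (i + 1) = q * i + q := Nat.mul_succ q i
      obtain ⟨r, hr0, hr1, hr2⟩ := h.exists_ratio (a := q * i + j) (m := q * (i + 1))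
        (c := q * (i + 1) + j) (by omega) (by omega) (by omega) (by omega)
      exact ⟨r, hr0, fun _ => ⟨hr1, hr2⟩⟩
    · exact ⟨1, one_pos, fun h => absurd h hi⟩
  choose r hr0 hr using hr
  -- With these products, passing from edge `i` to edge `i + 1` raises the scaled height before the
  -- boundary `q * (i + 1)` and lowers it after. Telescoping towards the group of `p` from either
  -- side gives the minimum at its own edge.
  let c : ℕ → ℝ := fun i => ∏ t ∈ Finset.range i, r t
  have hc0 : ∀ i, 0 < c i := fun i => Finset.prod_pos fun t _ => hr0 t
  have hcs : ∀ i, c (i + 1) = c i * r i := fun i => Finset.prod_range_succ _ _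
  refine ⟨c, hc0, fun i i' p hi hi' hp hp' => ?_⟩
  have hpk := mul_add_le_mul_of_lt (q := q) hi'
  rcases le_total i' i with hii | hii
  · induction i, hii using Nat.le_induction with
    | base => exact le_rfl
    | succ i hii ih =>
      refine (ih (by omega)).trans ?_
      have e1 := mul_add_le_mul_of_lt (q := q) (i := i') (k := i + 1) (by omega)
      rw [hcs, mul_assoc]
      exact mul_le_mul_of_nonneg_left ((hr i hi).1 p (by omega)) (hc0 i).le
  · have down : ∀ d ≤ i', c i' * heightAbove x y (q * i' + j) (q * i' + j + 1) p ≤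
        c (i' - d) * heightAbove x y (q * (i' - d) + j) (q * (i' - d) + j + 1) p := by
      intro d
      induction d with
      | zero => exact fun _ => le_rfl
      | succ d ih =>
        intro hd
        refine (ih (by omega)).trans ?_
        have e0 : i' - d = (i' - (d + 1)) + 1 := by omega
        have e1 : q * (i' - d) ≤ q * i' := Nat.mul_le_mul_left q (by omega)
        rw [e0] at e1 ⊢
        have key := (hr (i' - (d + 1)) (by omega)).2 p (by omega) (by omega)
        rw [hcs, mul_assoc]
        exact mul_le_mul_of_nonneg_left key (hc0 _).le
    have := down (i' - i) (by omega)
    rwa [Nat.sub_sub_self hii] at this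

/-- The cone of nonnegative affine functions on a tame chain of `q * k` points lies in a cone with
about `q + k` nonnegative generators. -/
theorem IsTame.exists_generators {q k : ℕ} {x y : ℕ → ℝ} (h : IsTame (q * k) x y) (hq : 3 ≤ q)
    (hk : 0 < k) :
    ∃ G : (Fin k × Fin 3) ⊕ Fin q ⊕ Fin k ⊕ Fin 3 → Fin (q * k) → ℝ, (∀ l p, 0 ≤ G l p) ∧
      ∀ α β γ : ℝ, (∀ p : Fin (q * k), 0 ≤ α + β * x p + γ * y p) →
        (fun p : Fin (q * k) => α + β * x p + γ * y p) ∈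
          Submodule.span ℝ≥0 (Set.range G) := by
  have hch := h.toIsConvexChain
  choose c hc0 hc using fun (j : ℕ) (hj : j + 1 < q) => h.exists_potential hq hj
  have hq0 : 0 < q := by omega
  have hdiv : ∀ (p : ℕ) (i : ℕ), p / q = i ↔ q * i ≤ p ∧ p < q * i + q := fun p i => by
    rw [Nat.div_eq_iff hq0, mul_comm q]
    omega
  have hmod : ∀ p, q * (p / q) ≤ p ∧ p < q * (p / q) + q := fun p => (hdiv p _).1 rfl
  have hpk : ∀ p < q * k, p / q < k := fun p hp => Nat.div_lt_of_lt_mul hp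
  have hqk : q ≤ q * k := Nat.le_mul_of_pos_right q hk
  -- `G₁` is supported on single groups: first edge, last edge, depth below the chord. `G₂` glues
  -- the scaled own-edge heights. `G₃` treats the edges joining consecutive groups, which is why
  -- `G₂` is zero at `j = q - 1`. `G₄` has the three global functions.
  let G₁ : Fin k × Fin 3 → Fin (q * k) → ℝ := fun l p => if (p : ℕ) / q = l.1 then
    ![heightAbove x y (q * l.1) (q * l.1 + 1) p,
      heightAbove x y (q * l.1 + (q - 2)) (q * l.1 + (q - 2) + 1) p,
      -heightAbove x y (q * l.1) (q * l.1 + (q - 2) + 1) p] l.2 else 0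
  let G₂ : Fin q → Fin (q * k) → ℝ := fun j p => if hj : (j : ℕ) + 1 < q then
    c j hj (p / q) * heightAbove x y (q * (p / q) + j) (q * (p / q) + j + 1) p else 0
  let G₃ : Fin k → Fin (q * k) → ℝ := fun i p => if (i : ℕ) + 1 < k then
    heightAbove x y (q * i + (q - 1)) (q * i + (q - 1) + 1) p else 0
  let G₄ : Fin 3 → Fin (q * k) → ℝ := ![fun p => x p - x 0, fun p => x (q * k - 1) - x p,
    fun p => -heightAbove x y 0 (q * k - 1) p]
  have depth : ∀ {a b p : ℕ}, a < b → b < q * k → a ≤ p → p ≤ b →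
      0 ≤ -heightAbove x y a b p := by
    intro a b p hab hb hap hpb
    rcases hap.eq_or_lt with rfl | hap
    · rw [heightAbove_left, neg_zero]
    rcases hpb.eq_or_lt with rfl | hpb
    · rw [hch.height_right hab hb, neg_zero]
    have h1 := hch.slope_lt hap hpb hb
    have h2 := hch.slope_mul hap (by omega)
    have h3 := hch.slope_mul hpb hb
    have h4 := hch.slope_mul hab hb
    have h5 := sub_pos.2 (hch.lt hap (by omega))
    have h6 := sub_pos.2 (hch.lt hpb hb)
    have h7 := sub_pos.2 (hch.lt hab hb)
    have h8 := mul_pos (mul_pos (sub_pos.2 h1) h5) h6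
    refine nonneg_of_mul_nonneg_left ?_ h7
    simp only [heightAbove]
    have : -(y p - y a - chordSlope x y a b * (x p - x a)) * (x b - x a) =
        (chordSlope x y p b - chordSlope x y a p) * (x p - x a) * (x b - x p) := by
      linear_combination (x p - x a) * h4 - (x p - x a) * h3 + (x b - x p) * h2
    rw [this]
    exact h8.le
  refine ⟨Sum.elim G₁ (Sum.elim G₂ (Sum.elim G₃ G₄)), ?_, ?_⟩
  · rintro (⟨i, e⟩ | j | i | e) p
    · change 0 ≤ G₁ (i, e) p
      simp only [G₁]
      split_ifs with hp
      · have h1 := mul_add_le_mul_of_lt (q := q) i.2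
        obtain ⟨h2, h3⟩ := (hdiv _ _).1 hp
        fin_cases e
        · exact hch.height_succ_nonneg (by omega) p.2
        · exact hch.height_succ_nonneg (by omega) p.2
        · exact depth (by omega) (by omega) (by omega) (by omega)
      · exact le_rfl
    · change 0 ≤ G₂ j p
      simp only [G₂]
      split_ifs with hj
      · have h1 := mul_add_le_mul_of_lt (q := q) (hpk p p.2)
        exact mul_nonneg (hc0 _ hj _).le (hch.height_succ_nonneg (by omega) p.2)
      · exact le_rfl
    · change 0 ≤ G₃ i p
      simp only [G₃]
      split_ifs with hi
      · have h1 := mul_add_le_mul_of_lt (q := q) hi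
        rw [Nat.mul_succ] at h1
        exact hch.height_succ_nonneg (by omega) p.2
      · exact le_rfl
    · change 0 ≤ G₄ e p
      fin_cases e
      · exact sub_nonneg.2 (hch.le (by omega) p.2)
      · exact sub_nonneg.2 (hch.le (by omega) (by omega))
      · exact depth (by omega) (by omega) (by omega) (by omega)
  set K := Submodule.span ℝ≥0 (Set.range (Sum.elim G₁ (Sum.elim G₂ (Sum.elim G₃ G₄)))) with hK
  have m1 : ∀ l, G₁ l ∈ K := fun l => Submodule.subset_span ⟨Sum.inl l, rfl⟩
  have m2 : ∀ l, G₂ l ∈ K := fun l => Submodule.subset_span ⟨Sum.inr (Sum.inl l), rfl⟩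
  have m3 : ∀ l, G₃ l ∈ K := fun l => Submodule.subset_span ⟨Sum.inr (Sum.inr (Sum.inl l)), rfl⟩
  have m4 : ∀ l, G₄ l ∈ K := fun l => Submodule.subset_span ⟨Sum.inr (Sum.inr (Sum.inr l)), rfl⟩
  have hedge : ∀ s, s + 1 < q * k → (fun p : Fin (q * k) => heightAbove x y s (s + 1) p) ∈ K := by
    intro s hs
    obtain ⟨i, j, hj, rfl⟩ : ∃ i j, j < q ∧ s = q * i + j :=
      ⟨s / q, s % q, Nat.mod_lt _ hq0, (Nat.div_add_mod s q).symm⟩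
    have hik : i < k := by
      by_contra hcon
      have := Nat.mul_le_mul_left q (not_lt.1 hcon)
      omega
    by_cases hj1 : j + 1 < q
    · have hci := hc0 j hj1 i
      -- The scaled height above edge `j` of group `i` equals the glued function plus these
      -- corrections, one for each group. By the choice of the scaling each correction is
      -- nonnegative at the ends of its group.
      have piece : ∀ i' : Fin k, (fun p : Fin (q * k) => if (p : ℕ) / q = i' then
          c j hj1 i * heightAbove x y (q * i + j) (q * i + j + 1) p -
          c j hj1 i' * heightAbove x y (q * i' + j) (q * i' + j + 1) p else 0) ∈ K := by
        intro i'
        by_cases hii : (i' : ℕ) = i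
        · convert K.zero_mem using 1
          ext p
          simp [hii]
        · have h1 := mul_add_le_mul_of_lt (q := q) i'.2
          have h2 := mul_add_le_mul_of_lt (q := q) hik
          refine hch.indicator_mem (A := q * i') (B := q * i' + (q - 2)) (a := q * i' + j)
            (e := q * i + j) (by omega) (by omega) (by omega) (by omega) ?_ (by omega)
            {p : Fin (q * k) | (p : ℕ) / q = i'} K (m1 (i', 0)) (m1 (i', 1)) (m1 (i', 2))
            (hc0 j hj1 _).le hci.le (hc j hj1 i i' _ hik i'.2 (by omega) (by omega))
            (hc j hj1 i i' _ hik i'.2 (by omega) (by omega))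
          rcases Nat.lt_or_gt_of_ne hii with hlt | hlt
          · have := mul_add_le_mul_of_lt (q := q) hlt
            omega
          · have := mul_add_le_mul_of_lt (q := q) hlt
            omega
      have tot := smul_mem_of_nonneg K (K.add_mem (m2 ⟨j, hj⟩)
        (K.sum_mem fun i' (_ : i' ∈ Finset.univ) => piece i')) (inv_nonneg.2 hci.le)
      convert tot using 1
      ext p
      rw [Pi.add_apply, Finset.sum_apply,
        Finset.sum_eq_single (⟨(p : ℕ) / q, hpk p p.2⟩ : Fin k)]
      · simp only [G₂, hj1, dif_pos, if_pos]
        field_simp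
        ring
      · intro b _ hb
        rw [if_neg]
        intro hcon
        exact hb (Fin.ext hcon.symm)
      · simp
    · have hj2 : j = q - 1 := by omega
      subst hj2
      have hi1 : i + 1 < k := by
        by_contra hcon
        have h1 := Nat.mul_le_mul_left q (not_lt.1 hcon)
        rw [Nat.mul_succ] at h1
        omega
      convert m3 ⟨i, hik⟩ using 1
      ext p
      simp only [G₃, hi1, if_true]
  intro α β γ hg
  obtain ⟨N, hN⟩ : ∃ N, q * k = N + 2 := ⟨q * k - 2, by omega⟩
  have n4 : (fun p : Fin (q * k) => x p - x 0) ∈ K ∧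
    (fun p : Fin (q * k) => x (q * k - 1) - x p) ∈ K ∧
    (fun p : Fin (q * k) => -heightAbove x y 0 (q * k - 1) p) ∈ K := ⟨m4 0, m4 1, m4 2⟩
  -- The generators are forgotten so that the size `q * k`, on which types depend, can be replaced
  -- by `N + 2`.
  clear_value K
  clear hK m1 m2 m3 m4 G₁ G₂ G₃ G₄ depth hpk hqk hc hc0 h
  generalize q * k = n at *
  subst hN
  exact hch.affine_mem K hedge n4.1 n4.2.1 n4.2.2 α β γ hg

/-! ### Nonnegative factorizations of sets of rows. -/

/-- The rows of `A` in `S` have a nonnegative factorization of inner size at most `r`. -/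
def HasNonnegFac {m n : Type*} (A : Matrix m n ℝ) (S : Finset m) (r : ℕ) : Prop :=
  ∃ (κ : Type) (_ : Fintype κ), Fintype.card κ ≤ r ∧ ∃ (B : m → κ → ℝ) (C : κ → n → ℝ),
    (∀ i ∈ S, ∀ l, 0 ≤ B i l) ∧ (∀ l j, 0 ≤ C l j) ∧ ∀ i ∈ S, ∀ j, A i j = ∑ l, B i l * C l j

theorem Matrix.eq_zero_of_rank_eq_zero {m n : Type*} [Fintype m] [Fintype n] {M : Matrix m n ℝ}
    (h : M.rank = 0) : M = 0 := by
  classical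
  rw [Matrix.rank, Submodule.finrank_eq_zero, LinearMap.range_eq_bot] at h
  ext i j
  simpa using congrFun (LinearMap.congr_fun h (Pi.single j 1)) i

theorem HasNonnegFac.nonnegRank_le {m n : Type*} [Fintype m] [Fintype n] {A : Matrix m n ℝ} {r : ℕ}
    (h : HasNonnegFac A Finset.univ r) : nonnegRank A ≤ r := by
  classical
  obtain ⟨κ, _, hκ, B, C, hB, hC, hA⟩ := h
  let M : κ → Matrix m n ℝ := fun l => Matrix.vecMulVec (fun i => B i l) (C l)
  let e := Fintype.equivFin {l // M l ≠ 0}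
  refine (Nat.sInf_le ?_).trans ((Fintype.card_subtype_le (fun l => M l ≠ 0)).trans hκ)
  refine ⟨fun t => M (e.symm t), fun t => ⟨fun i j => ?_, ?_⟩, ?_⟩
  · exact mul_nonneg (hB i (Finset.mem_univ i) _) (hC _ j)
  · refine le_antisymm (Matrix.rank_vecMulVec_le _ _) ?_
    rw [Nat.one_le_iff_ne_zero]
    exact fun h0 => (e.symm t).2 (Matrix.eq_zero_of_rank_eq_zero h0)
  · rw [Equiv.sum_comp e.symm (fun p : {l // M l ≠ 0} => M p)]
    rw [← Finset.sum_subtype (Finset.univ.filter fun l => M l ≠ 0) (fun l => by simp) M,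
      Finset.sum_filter_ne_zero]
    ext i j
    rw [hA i (Finset.mem_univ i) j, Matrix.sum_apply]
    rfl

theorem HasNonnegFac.union {m n : Type*} [DecidableEq m] {A : Matrix m n ℝ} {S T : Finset m}
    {r s : ℕ} (hS : HasNonnegFac A S r) (hT : HasNonnegFac A T s) :
    HasNonnegFac A (S ∪ T) (r + s) := by
  obtain ⟨κ, _, hκ, B, C, hB, hC, hA⟩ := hS
  obtain ⟨κ', _, hκ', B', C', hB', hC', hA'⟩ := hT
  refine ⟨κ ⊕ κ', inferInstance, by rw [Fintype.card_sum]; omega,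
    fun i => Sum.elim (fun l => if i ∈ S then B i l else 0)
      (fun l => if i ∈ S then 0 else B' i l), Sum.elim C C', ?_, ?_, ?_⟩
  · rintro i hi (l | l)
    · by_cases h : i ∈ S
      · simpa [h] using hB i h l
      · simp [h]
    · by_cases h : i ∈ S
      · simp [h]
      · simpa [h] using hB' i ((Finset.mem_union.1 hi).resolve_left h) l
  · rintro (l | l) j
    · exact hC l j
    · exact hC' l j
  · intro i hi j
    rw [Fintype.sum_sum_type]
    by_cases h : i ∈ S
    · simp [h, hA i h j]
    · simp [h, hA' i ((Finset.mem_union.1 hi).resolve_left h) j]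

theorem HasNonnegFac.mono {m n : Type*} {A : Matrix m n ℝ} {S T : Finset m}
    {r s : ℕ} (h : HasNonnegFac A S r) (hT : T ⊆ S) (hr : r ≤ s) : HasNonnegFac A T s := by
  obtain ⟨κ, i, hκ, B, C, hB, hC, hA⟩ := h
  exact ⟨κ, i, hκ.trans hr, B, C, fun i hi => hB i (hT hi), hC, fun i hi => hA i (hT hi)⟩

theorem hasNonnegFac_card {m n : ℕ} {A : Matrix (Fin m) (Fin n) ℝ} (hA : ∀ i j, 0 ≤ A i j)
    (S : Finset (Fin m)) : HasNonnegFac A S S.card := by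
  refine ⟨S, inferInstance, by simp, fun i l => if i = l then 1 else 0, fun l j => A l j,
    fun i _ l => by beta_reduce; split_ifs <;> norm_num, fun l j => hA l j, fun i hi j => ?_⟩
  rw [Finset.sum_eq_single ⟨i, hi⟩]
  · simp
  · intro b _ hb
    have hib : i ≠ b := fun h => hb (Subtype.ext h.symm)
    simp [hib]
  · simp

/-- The right factor stays the same: rows expressible through it with nonnegative coefficients form
a convex cone. -/
theorem HasNonnegFac.of_mem_span {m n : Type*} [Fintype m] {A : Matrix m n ℝ} {S : Finset m}
    {r : ℕ} (h : HasNonnegFac A S r)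
    (hS : ∀ i, A i ∈ Submodule.span ℝ≥0 (A '' (S : Set m))) :
    HasNonnegFac A Finset.univ r := by
  obtain ⟨κ, i, hκ, B, C, hB, hC, hA⟩ := h
  have key : ∀ f ∈ Submodule.span ℝ≥0 (A '' (S : Set m)), ∃ b : κ → ℝ, (∀ l, 0 ≤ b l) ∧
      ∀ j, f j = ∑ l, b l * C l j := by
    intro f hf
    induction hf using Submodule.span_induction with
    | mem f hf =>
      obtain ⟨i, hi, rfl⟩ := hf
      exact ⟨B i, hB i hi, hA i hi⟩
    | zero => exact ⟨0, fun _ => le_rfl, by simp⟩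
    | add f g _ _ hf hg =>
      obtain ⟨b, hb, hf⟩ := hf
      obtain ⟨c, hc, hg⟩ := hg
      exact ⟨b + c, fun l => add_nonneg (hb l) (hc l), fun j => by
        simp [hf, hg, add_mul, Finset.sum_add_distrib]⟩
    | smul t f _ hf =>
      obtain ⟨b, hb, hf⟩ := hf
      exact ⟨fun l => t * b l, fun l => mul_nonneg t.2 (hb l), fun j => by
        simp [hf, NNReal.smul_def, Finset.mul_sum, mul_assoc]⟩
  choose b hb hf using fun i => key (A i) (hS i)
  exact ⟨κ, _, hκ, b, C, fun i _ => hb i, hC, fun i _ => hf i⟩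

/-- Every matrix has a minimal set of rows generating all rows as nonnegative combinations. -/
theorem exists_minimal_generating {m n : Type*} [Fintype m] [DecidableEq m] (A : Matrix m n ℝ) :
    ∃ S : Finset m, (∀ i, A i ∈ Submodule.span ℝ≥0 (A '' (S : Set m))) ∧
      ∀ b ∈ S, A b ∉ Submodule.span ℝ≥0 (A '' (S.erase b : Set m)) := by
  obtain ⟨S, hS, hmin⟩ := (Set.toFinite
    {S : Finset m | ∀ i, A i ∈ Submodule.span ℝ≥0 (A '' (S : Set m))}).exists_minimalFor
    Finset.card _ ⟨Finset.univ, fun i => Submodule.subset_span ⟨i, by simp, rfl⟩⟩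
  refine ⟨S, hS, fun b hb hcon => ?_⟩
  have hle : Submodule.span ℝ≥0 (A '' (S : Set m)) ≤
      Submodule.span ℝ≥0 (A '' (S.erase b : Set m)) := by
    rw [Submodule.span_le]
    rintro _ ⟨i, hi, rfl⟩
    by_cases hib : i = b
    · rw [hib]; exact hcon
    · exact Submodule.subset_span ⟨i, by simpa [hib] using hi, rfl⟩
  have := hmin (j := S.erase b) (fun i => hle (hS i)) (Finset.card_erase_le)
  exact absurd (Finset.card_erase_lt_of_mem hb) (not_lt.2 this)

/-- If every large set of rows contains a block of `t` rows of factorization size at most `r`, then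
the blocks can be removed one after the other. -/
theorem hasNonnegFac_of_blocks {m n : ℕ} {A : Matrix (Fin m) (Fin n) ℝ} (hA : ∀ i j, 0 ≤ A i j)
    {t r N : ℕ} (ht : 0 < t) (S : Finset (Fin m))
    (hblock : ∀ T ⊆ S, N ≤ T.card → ∃ U ⊆ T, U.card = t ∧ HasNonnegFac A U r) :
    HasNonnegFac A S (S.card / t * r + N) := by
  induction hc : S.card using Nat.strong_induction_on generalizing S with
  | _ c ih =>
    by_cases hN : N ≤ S.card
    · obtain ⟨U, hUS, hUt, hU⟩ := hblock S subset_rfl hN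
      have hcard : (S \ U).card = c - t := by rw [Finset.card_sdiff_of_subset hUS, hc, hUt]
      have htc : t ≤ c := by rw [← hUt, ← hc]; exact Finset.card_le_card hUS
      have h1 := ih (c - t) (by omega) (S \ U)
        (fun T hT => hblock T (hT.trans Finset.sdiff_subset)) hcard
      have h2 := h1.union hU
      rw [Finset.sdiff_union_of_subset hUS] at h2
      refine h2.mono subset_rfl (le_of_eq ?_)
      have : c / t = (c - t) / t + 1 := by
        rw [Nat.div_eq_sub_div ht htc]
      rw [this]
      ring
    · exact (hasNonnegFac_card hA S).mono subset_rfl (by omega)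

/-! ### From independent rows to convex chains. -/

theorem Convex.mem_of_mem_of_mem {C : Set (ℝ × ℝ)} (hC : Convex ℝ C) {x₁ y₁ x₂ y₂ x : ℝ}
    (h₁ : (x₁, y₁) ∈ C) (h₂ : (x₂, y₂) ∈ C) (hx₁ : x₁ < x) (hx₂ : x < x₂) :
    (x, ((x₂ - x) * y₁ + (x - x₁) * y₂) / (x₂ - x₁)) ∈ C := by
  have h := sub_pos.2 (hx₁.trans hx₂)
  convert hC h₁ h₂ (div_nonneg (sub_pos.2 hx₂).le h.le) (div_nonneg (sub_pos.2 hx₁).le h.le)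
    (by rw [← add_div, div_eq_one_iff_eq h.ne']; ring) using 1
  ext
  · simp only [Prod.smul_mk, Prod.mk_add_mk, smul_eq_mul]
    field_simp
    ring
  · simp only [Prod.smul_mk, Prod.mk_add_mk, smul_eq_mul]
    field_simp

theorem Convex.mem_of_vertical {C : Set (ℝ × ℝ)} (hC : Convex ℝ C) {x y₁ y₂ y : ℝ}
    (h₁ : (x, y₁) ∈ C) (h₂ : (x, y₂) ∈ C) (hy₁ : y₁ ≤ y) (hy₂ : y ≤ y₂) : (x, y) ∈ C := by
  rcases (hy₁.trans hy₂).eq_or_lt with rfl | h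
  · rwa [le_antisymm hy₂ hy₁]
  have h := sub_pos.2 h
  convert hC h₁ h₂ (div_nonneg (sub_nonneg.2 hy₂) h.le) (div_nonneg (sub_nonneg.2 hy₁) h.le)
    (by rw [← add_div, div_eq_one_iff_eq h.ne']; ring) using 1
  ext
  · simp only [Prod.smul_mk, Prod.mk_add_mk, smul_eq_mul]
    field_simp
    ring
  · simp only [Prod.smul_mk, Prod.mk_add_mk, smul_eq_mul]
    field_simp
    ring

/-- No point is in the convex hull of the others. -/
def InConvexPosition {ι : Type*} [DecidableEq ι] (S : Finset ι) (X Y : ι → ℝ) : Prop :=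
  ∀ b ∈ S, (X b, Y b) ∉ convexHull ℝ ((fun e => (X e, Y e)) '' (S.erase b : Set ι))

theorem InConvexPosition.neg {ι : Type*} [DecidableEq ι] {S : Finset ι} {X Y : ι → ℝ}
    (h : InConvexPosition S X Y) : InConvexPosition S X (fun i => -Y i) := by
  intro b hb hcon
  refine h b hb ?_
  let f : ℝ × ℝ →ₗ[ℝ] ℝ × ℝ := LinearMap.prodMap LinearMap.id (-LinearMap.id)
  have h1 := Set.mem_image_of_mem f hcon
  rw [f.image_convexHull, ← Set.image_comp] at h1
  simpa [f, Function.comp_def] using h1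

/-- Points in convex position below the chord of their extreme points form a convex chain. -/
theorem InConvexPosition.exists_chain_of_below {ι : Type*} [DecidableEq ι] {S : Finset ι}
    {X Y : ι → ℝ} (h : InConvexPosition S X Y) (hX : Set.InjOn X S) {l r : ι} (hl : l ∈ S)
    (hr : r ∈ S) (hlX : ∀ i ∈ S, X l ≤ X i) (hrX : ∀ i ∈ S, X i ≤ X r) {T : Finset ι} (hT : T ⊆ S)
    (hbelow : ∀ i ∈ T, Y i * (X r - X l) ≤ (X r - X i) * Y l + (X i - X l) * Y r) {N : ℕ}
    (hN : N ≤ T.card) :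
    ∃ p : ℕ → ι, (∀ a < N, p a ∈ T) ∧
      IsConvexChain N (fun a => X (p a)) (fun a => Y (p a)) := by
  classical
  have hcard : N ≤ (T.image X).card := by
    rwa [Finset.card_image_of_injOn (hX.mono hT)]
  obtain ⟨U, hUT, hUc⟩ := Finset.exists_subset_card_eq hcard
  let e := U.orderEmbOfFin hUc
  have hex : ∀ a : Fin N, ∃ i ∈ T, X i = e a := fun a =>
    Finset.mem_image.1 (hUT (U.orderEmbOfFin_mem hUc a))
  choose f hfT hfX using hex
  refine ⟨fun a => if ha : a < N then f ⟨a, ha⟩ else l, fun a ha => ?_, ?_, ?_⟩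
  · simp only [ha, dif_pos, hfT]
  · intro a b hab hb
    simp only [hb, hab.trans hb, dif_pos, hfX]
    exact e.strictMono hab
  · intro a b c hab hbc hc
    have hb := hbc.trans hc
    have ha := hab.trans hb
    simp only [ha, hb, hc, dif_pos]
    have iab : X (f ⟨a, ha⟩) < X (f ⟨b, hb⟩) := by
      rw [hfX, hfX]; exact e.strictMono hab
    have ibc : X (f ⟨b, hb⟩) < X (f ⟨c, hc⟩) := by
      rw [hfX, hfX]; exact e.strictMono hbc
    have ia := hfT ⟨a, ha⟩
    have ib := hfT ⟨b, hb⟩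
    have ic := hfT ⟨c, hc⟩
    generalize f ⟨a, ha⟩ = i at *
    generalize f ⟨b, hb⟩ = j at *
    generalize f ⟨c, hc⟩ = k at *
    by_contra hcon
    rw [not_lt] at hcon
    refine h j (hT ib) ?_
    have mem : ∀ t ∈ S, X t ≠ X j →
        (X t, Y t) ∈ convexHull ℝ ((fun e => (X e, Y e)) '' (S.erase j : Set ι)) := by
      intro t ht htj
      refine subset_convexHull ℝ _ ⟨t, ?_, rfl⟩
      simp only [Finset.coe_erase, Set.mem_sdiff, Finset.mem_coe, Set.mem_singleton_iff]
      exact ⟨ht, fun h => htj (by rw [h])⟩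
    have hlj := (hlX i (hT ia)).trans_lt iab
    have hjr := ibc.trans_le (hrX k (hT ic))
    have hC := convex_convexHull ℝ ((fun e => (X e, Y e)) '' (S.erase j : Set ι))
    -- If convexity failed at `j`, this point would lie on or above the chord `ik` and on or below
    -- the chord `lr`, hence on a vertical segment between two points of the hull of the others.
    refine hC.mem_of_vertical
      (hC.mem_of_mem_of_mem (mem i (hT ia) iab.ne) (mem k (hT ic) ibc.ne') iab ibc)
      (hC.mem_of_mem_of_mem (mem l hl hlj.ne) (mem r hr hjr.ne') hlj hjr) ?_ ?_
    · rw [div_le_iff₀ (by linarith)]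
      linarith
    · rw [le_div_iff₀ (by linarith)]
      exact hbelow j ib

/-- The chord of the extreme points splits the set, and one part has at least half of it. Points
above the chord are reflected; `ε` is the sign of the reflection. -/
theorem InConvexPosition.exists_chain {ι : Type*} [DecidableEq ι] {S : Finset ι}
    {X Y : ι → ℝ} (h : InConvexPosition S X Y) (hX : Set.InjOn X S) {N : ℕ} (hN0 : 0 < N)
    (hN : 2 * N ≤ S.card) :
    ∃ (p : ℕ → ι) (ε : ℝ), ε * ε = 1 ∧ (∀ a < N, p a ∈ S) ∧
      IsConvexChain N (fun a => X (p a)) (fun a => ε * Y (p a)) := by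
  classical
  have hne : S.Nonempty := Finset.card_pos.1 (by omega)
  obtain ⟨l, hl, hlX⟩ := S.exists_min_image X hne
  obtain ⟨r, hr, hrX⟩ := S.exists_max_image X hne
  set P : ι → Prop := fun i => Y i * (X r - X l) ≤ (X r - X i) * Y l + (X i - X l) * Y r with hP
  have hsum := Finset.card_filter_add_card_filter_not (s := S) P
  by_cases hc : N ≤ (S.filter P).card
  · obtain ⟨p, hp, hch⟩ := h.exists_chain_of_below hX hl hr hlX hrX (Finset.filter_subset _ _)
      (fun i hi => (Finset.mem_filter.1 hi).2) hc
    exact ⟨p, 1, by norm_num, fun a ha => Finset.filter_subset _ _ (hp a ha), by simpa using hch⟩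
  · obtain ⟨p, hp, hch⟩ := h.neg.exists_chain_of_below hX hl hr hlX hrX
      (T := S.filter fun i => ¬ P i) (N := N) (Finset.filter_subset _ _)
      (fun i hi => by
        have := (Finset.mem_filter.1 hi).2
        simp only [hP, not_le] at this
        linarith) (by omega)
    exact ⟨p, -1, by norm_num, fun a ha => Finset.filter_subset _ _ (hp a ha), by simpa using hch⟩

theorem exists_spanning_triple {V : Type*} [AddCommGroup V] [Module ℝ V]
    (hV : Module.finrank ℝ V = 3) {w : V} (hw : w ≠ 0) :
    ∃ b₀ b₁ : V, ∀ v, ∃ α β γ : ℝ, v = α • w + β • b₀ + γ • b₁ := by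
  have : FiniteDimensional ℝ V := FiniteDimensional.of_finrank_eq_succ hV
  obtain ⟨Q, hQ⟩ := Submodule.exists_isCompl (Submodule.span ℝ {w})
  have hQ2 : Module.finrank ℝ Q = 2 := by
    have := Submodule.finrank_add_eq_of_isCompl hQ
    rw [finrank_span_singleton hw, hV] at this
    omega
  let b := Module.finBasisOfFinrankEq ℝ Q hQ2
  refine ⟨b 0, b 1, fun v => ?_⟩
  have hmem : v ∈ Submodule.span ℝ {w} ⊔ Q := by
    rw [hQ.sup_eq_top]; trivial
  obtain ⟨s, hs, q, hq, rfl⟩ := Submodule.mem_sup.1 hmem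
  obtain ⟨α, rfl⟩ := Submodule.mem_span_singleton.1 hs
  refine ⟨α, b.repr ⟨q, hq⟩ 0, b.repr ⟨q, hq⟩ 1, ?_⟩
  have h1 := congrArg Subtype.val (b.sum_repr ⟨q, hq⟩)
  rw [Fin.sum_univ_two] at h1
  rw [add_assoc]
  congr 1
  exact h1.symm

/-- The columns of a matrix of rank three are combinations of the row sums and two more vectors. -/
theorem exists_coordinates {m n : ℕ} {A : Matrix (Fin m) (Fin n) ℝ} (hA : ∀ i j, 0 ≤ A i j)
    (hr : A.rank = 3) :
    ∃ (u v : Fin m → ℝ) (α β γ : Fin n → ℝ), ∀ i j,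
      A i j = α j * (∑ t, A i t) + β j * u i + γ j * v i := by
  let V := Submodule.span ℝ (Set.range A.col)
  have hV : Module.finrank ℝ V = 3 := by rw [← hr, Matrix.rank_eq_finrank_span_cols]
  have hcol : ∀ j, A.col j ∈ V := fun j => Submodule.subset_span ⟨j, rfl⟩
  -- The vector of row sums serves as homogenizing coordinate. It is nonzero because `A` is
  -- nonnegative and not zero.
  let w : V := ⟨∑ t, A.col t, V.sum_mem fun t _ => hcol t⟩
  have hw : w ≠ 0 := by
    intro h0
    have h1 : ∀ i, ∑ t, A i t = 0 := fun i => by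
      have := congrFun (congrArg Subtype.val h0) i
      simpa [w, Matrix.col_apply] using this
    have h2 : A = 0 := by
      ext i j
      exact (Finset.sum_eq_zero_iff_of_nonneg fun t _ => hA i t).1 (h1 i) j (Finset.mem_univ j)
    rw [h2, Matrix.rank_zero] at hr
    omega
  obtain ⟨b₀, b₁, hb⟩ := exists_spanning_triple hV hw
  have key : ∀ j, ∃ α β γ : ℝ, ∀ i, A i j = α * (∑ t, A i t) + β * b₀.1 i + γ * b₁.1 i := by
    intro j
    obtain ⟨α, β, γ, h⟩ := hb ⟨A.col j, hcol j⟩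
    refine ⟨α, β, γ, fun i => ?_⟩
    have := congrFun (congrArg Subtype.val h) i
    simpa [w, Matrix.col_apply] using this
  choose α β γ h using key
  exact ⟨_, _, α, β, γ, fun i j => h j i⟩

/-- Each pair of points with distinct ordinates excludes only one `θ`. Distinct abscissas are needed
to order the points into a chain. -/
theorem exists_shear {ι : Type*} (S : Finset ι) (X Y : ι → ℝ)
    (h : ∀ i ∈ S, ∀ e ∈ S, X i = X e → Y i = Y e → i = e) :
    ∃ θ : ℝ, Set.InjOn (fun i => X i + θ * Y i) S := by
  classical
  obtain ⟨θ, hθ⟩ := Infinite.exists_notMem_finset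
    ((S ×ˢ S).image fun t => (X t.2 - X t.1) / (Y t.1 - Y t.2))
  refine ⟨θ, fun i hi e he hie => ?_⟩
  simp only at hie
  by_cases hY : Y i = Y e
  · rw [hY] at hie
    exact h i hi e he (by linarith) hY
  · refine absurd (Finset.mem_image.2 ⟨(i, e), Finset.mem_product.2 ⟨hi, he⟩, ?_⟩) hθ
    simp only
    rw [div_eq_iff (sub_ne_zero.2 hY)]
    linarith

/-- Among independent rows of a nonnegative matrix of rank three one finds a convex chain. -/
theorem exists_chain_rows {m n : ℕ} {A : Matrix (Fin m) (Fin n) ℝ} (hA : ∀ i j, 0 ≤ A i j)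
    (hr : A.rank = 3) {S : Finset (Fin m)}
    (hS : ∀ b ∈ S, A b ∉ Submodule.span ℝ≥0 (A '' (S.erase b : Set (Fin m)))) {N : ℕ}
    (hN0 : 0 < N) (hN : 2 * N ≤ S.card) :
    ∃ (p : ℕ → Fin m) (w x y : ℕ → ℝ) (α β γ : Fin n → ℝ), (∀ a < N, p a ∈ S) ∧
      (∀ a < N, 0 < w a) ∧ (∀ a b, p a = p b → x a = x b) ∧ IsConvexChain N x y ∧
      ∀ j, ∀ a < N, A (p a) j = w a * (α j + β j * x a + γ j * y a) := by
  classical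
  obtain ⟨u, v, α, β, γ, hc⟩ := exists_coordinates hA hr
  set W : Fin m → ℝ := fun i => ∑ t, A i t with hW
  have hW0 : ∀ i ∈ S, 0 < W i := by
    intro i hi
    refine lt_of_le_of_ne (Finset.sum_nonneg fun t _ => hA i t) fun h0 => hS i hi ?_
    have : A i = 0 := by
      ext j
      exact (Finset.sum_eq_zero_iff_of_nonneg fun t _ => hA i t).1 h0.symm j (Finset.mem_univ j)
    rw [this]
    exact Submodule.zero_mem _
  have hself : ∀ b ∈ S, ∀ e ∈ S, e ≠ b →
      A e ∈ Submodule.span ℝ≥0 (A '' (S.erase b : Set (Fin m))) := fun b _ e he heb =>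
    Submodule.subset_span ⟨e, by simp [he, heb], rfl⟩
  have hrow : ∀ i ∈ S, ∀ j, A i j = W i * (α j + β j * (u i / W i) + γ j * (v i / W i)) := by
    intro i hi j
    have := (hW0 i hi).ne'
    rw [hc i j]
    change α j * W i + _ + _ = _
    field_simp
  -- Two rows with the same point would be positive multiples of each other, against independence.
  obtain ⟨θ, hθ⟩ := exists_shear S (fun i => u i / W i) (fun i => v i / W i) (by
    intro i hi e he h1 h2
    by_contra hne
    refine hS i hi ?_
    have := smul_mem_of_nonneg _ (hself i hi e he (Ne.symm hne))
      (div_nonneg (hW0 i hi).le (hW0 e he).le)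
    convert this using 1
    ext j
    rw [hrow i hi, hrow e he]
    rw [h1, h2]
    have := (hW0 e he).ne'
    field_simp)
  set X : Fin m → ℝ := fun i => u i / W i + θ * (v i / W i) with hX
  set Y : Fin m → ℝ := fun i => v i / W i with hY
  have hrow' : ∀ i ∈ S, ∀ j, A i j = W i * (α j + β j * X i + (γ j - β j * θ) * Y i) := by
    intro i hi j
    rw [hrow i hi]
    simp only [hX, hY]
    ring
  have hpos : InConvexPosition S X Y := by
    intro b hb hcon
    -- The points whose row lies in the cone of the other rows form a convex set, so a point in the
    -- hull of the others would make its row dependent.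
    let C : Set (ℝ × ℝ) := {P | (fun j => α j + β j * P.1 + (γ j - β j * θ) * P.2) ∈
      Submodule.span ℝ≥0 (A '' (S.erase b : Set (Fin m)))}
    have hC : Convex ℝ C := by
      intro P hP Q hQ s t hs ht hst
      simp only [C, Set.mem_ofPred_eq] at hP hQ
      have := Submodule.add_mem _ (smul_mem_of_nonneg _ hP hs) (smul_mem_of_nonneg _ hQ ht)
      simp only [C, Set.mem_ofPred_eq]
      convert this using 1
      ext j
      simp only [Prod.fst_add, Prod.snd_add, Prod.smul_fst, Prod.smul_snd, smul_eq_mul,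
        Pi.add_apply]
      linear_combination (-(α j)) * hst
    have hsub : convexHull ℝ ((fun e => (X e, Y e)) '' (S.erase b : Set (Fin m))) ⊆ C := by
      refine convexHull_min ?_ hC
      rintro _ ⟨e, he, rfl⟩
      simp only [Finset.coe_erase, Set.mem_sdiff, Finset.mem_coe, Set.mem_singleton_iff] at he
      have := smul_mem_of_nonneg _ (hself b hb e he.1 he.2) (inv_nonneg.2 (hW0 e he.1).le)
      simp only [C, Set.mem_ofPred_eq]
      convert this using 1
      ext j
      rw [hrow' e he.1, inv_mul_cancel_left₀ (hW0 e he.1).ne']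
    refine hS b hb ?_
    have hbC := hsub hcon
    simp only [C, Set.mem_ofPred_eq] at hbC
    have := smul_mem_of_nonneg _ hbC (hW0 b hb).le
    convert this using 1
    ext j
    rw [hrow' b hb]
  obtain ⟨p, ε, hε, hp, hch⟩ := hpos.exists_chain hθ hN0 hN
  refine ⟨p, fun a => W (p a), _, _, α, β, fun j => (γ j - β j * θ) * ε, hp,
    fun a ha => hW0 _ (hp a ha), fun a b hab => by rw [hab], hch, fun j a ha => ?_⟩
  rw [hrow' _ (hp a ha)]
  linear_combination (-W (p a) * (γ j - β j * θ) * Y (p a)) * hε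

/-! ### Blocks of rows with small factorizations. -/

/-- Many independent rows contain `q * k` rows with a nonnegative factorization of size about
`q + k`. -/
theorem exists_block {m n : ℕ} {A : Matrix (Fin m) (Fin n) ℝ} (hA : ∀ i j, 0 ≤ A i j)
    (hr : A.rank = 3) {S : Finset (Fin m)}
    (hS : ∀ b ∈ S, A b ∉ Submodule.span ℝ≥0 (A '' (S.erase b : Set (Fin m)))) {q k : ℕ}
    (hq : 3 ≤ q) (hk : 0 < k) (hqk : 13 ≤ q * k)
    (hN0 : 0 < ramseyBound 4 (q * k) 5) (hN : 2 * ramseyBound 4 (q * k) 5 ≤ S.card) :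
    ∃ U ⊆ S, U.card = q * k ∧ HasNonnegFac A U (4 * k + q + 3) := by
  classical
  obtain ⟨p, w, x, y, α, β, γ, hp, hw, hpx, hch, hc⟩ := exists_chain_rows hA hr hS hN0 hN
  obtain ⟨φ, -, hφN, ht⟩ := hch.exists_isTame hqk le_rfl
  obtain ⟨G, hG, hGc⟩ := ht.exists_generators hq hk
  let f : Fin (q * k) → Fin m := fun a => p (φ a)
  have hf : Function.Injective f := by
    intro a b hab
    have h1 := hpx _ _ hab
    rcases lt_trichotomy a b with h | h | h
    · exact absurd h1 (ht.lt h b.2).ne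
    · exact h
    · exact absurd h1 (ht.lt h a.2).ne'
  have hcol : ∀ j, ∃ C : (Fin k × Fin 3) ⊕ Fin q ⊕ Fin k ⊕ Fin 3 → ℝ≥0, ∀ a : Fin (q * k),
      α j + β j * x (φ a) + γ j * y (φ a) = ∑ l, (C l : ℝ) * G l a := by
    intro j
    have h1 := hGc (α j) (β j) (γ j) (fun a => by
      have h2 := hA (p (φ a)) j
      rw [hc j _ (hφN a a.2)] at h2
      exact nonneg_of_mul_nonneg_right h2 (hw _ (hφN a a.2)))
    rw [Submodule.mem_span_range_iff_exists_fun] at h1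
    obtain ⟨C, hC⟩ := h1
    refine ⟨C, fun a => ?_⟩
    rw [← congrFun hC a, Finset.sum_apply]
    rfl
  choose C hC using hcol
  -- The left factor holds the generator values rescaled by row sums; the right factor holds the
  -- coefficients of the columns.
  refine ⟨Finset.univ.image f, ?_, ?_, (Fin k × Fin 3) ⊕ Fin q ⊕ Fin k ⊕ Fin 3, inferInstance, ?_,
    fun i l => if hi : ∃ a, f a = i then w (φ hi.choose) * G l hi.choose else 0,
    fun l j => C j l, ?_, fun l j => (C j l).2, ?_⟩
  · intro i hi
    obtain ⟨a, -, rfl⟩ := Finset.mem_image.1 hi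
    exact hp _ (hφN a a.2)
  · rw [Finset.card_image_of_injective _ hf, Finset.card_univ, Fintype.card_fin]
  · simp only [Fintype.card_sum, Fintype.card_prod, Fintype.card_fin]
    omega
  · intro i _ l
    beta_reduce
    split_ifs with hi
    · exact mul_nonneg (hw _ (hφN _ (Fin.is_lt _))).le (hG _ _)
    · exact le_rfl
  · intro i hi j
    obtain ⟨a, -, rfl⟩ := Finset.mem_image.1 hi
    have hex : ∃ b, f b = f a := ⟨a, rfl⟩
    have hch : hex.choose = a := hf hex.choose_spec
    simp only [hex, dif_pos, hch]
    change A (p (φ a)) j = _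
    rw [hc j _ (hφN a a.2), hC j a, Finset.mul_sum]
    exact Finset.sum_congr rfl fun l _ => by ring

/-! ### Size of the Ramsey bound and the final estimates. -/

theorem ramseyBound_pos {κ n : ℕ} (hκ : 0 < κ) (hn : 0 < n) (r : ℕ) : 0 < ramseyBound κ n r := by
  cases r with
  | zero => exact Nat.mul_pos hκ hn
  | succ r => simp only [ramseyBound]; positivity

/-- The shape `exp ((b - 3) / 7)` reproduces itself with `b` replaced by `exp b`. If `M ≤ exp a`
with `7 * a = b - 3`, the next bound is at most `exp (3 * M ^ 6) ≤ exp (exp (7 * a))`, where 7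
instead of 6 absorbs the factor 3 and the shift by 3 absorbs the division by 7, as `exp 3 ≥ 8`. -/
theorem ramseyBound_succ_le {n r : ℕ} (hn : 0 < n) (hr : r + 2 ≤ 6) {b : ℝ} (hb : 17 ≤ b)
    (h : (ramseyBound 4 n r : ℝ) ≤ Real.exp ((b - 3) / 7)) :
    (ramseyBound 4 n (r + 1) : ℝ) ≤ Real.exp ((Real.exp b - 3) / 7) := by
  set M := ramseyBound 4 n r with hM
  have hM1 : 1 ≤ M := ramseyBound_pos (by norm_num) hn r
  have hM1' : (1 : ℝ) ≤ M := by exact_mod_cast hM1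
  set a := (b - 3) / 7 with ha
  have ha2 : 2 ≤ a := by rw [ha]; linarith
  have h2 : (2 : ℝ) ≤ Real.exp 1 := by have := Real.add_one_le_exp (1 : ℝ); linarith
  have h4 : (4 : ℝ) ≤ Real.exp 2 := by
    have : Real.exp 2 = Real.exp 1 * Real.exp 1 := by rw [← Real.exp_add]; norm_num
    nlinarith
  have e1 : (ramseyBound 4 n (r + 1) : ℝ) = 2 ^ M * 4 ^ M ^ (r + 2) := by
    simp [ramseyBound, hM]
  have e2 : (2 : ℝ) ^ M ≤ Real.exp ((M : ℝ) ^ 6) := by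
    calc (2 : ℝ) ^ M ≤ Real.exp 1 ^ M := pow_le_pow_left₀ (by norm_num) h2 M
      _ = Real.exp M := by rw [← Real.exp_nat_mul, mul_one]
      _ ≤ _ := Real.exp_le_exp.2 (le_self_pow₀ hM1' (by norm_num))
  have e3 : (4 : ℝ) ^ M ^ (r + 2) ≤ Real.exp (2 * (M : ℝ) ^ 6) := by
    calc (4 : ℝ) ^ M ^ (r + 2) ≤ Real.exp 2 ^ M ^ (r + 2) :=
          pow_le_pow_left₀ (by norm_num) h4 _
      _ = Real.exp (2 * (M : ℝ) ^ (r + 2)) := by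
          rw [← Real.exp_nat_mul]; push_cast; ring_nf
      _ ≤ _ := Real.exp_le_exp.2
          (mul_le_mul_of_nonneg_left (pow_le_pow_right₀ hM1' hr) (by norm_num))
  have e4 : (M : ℝ) ^ 6 ≤ Real.exp (6 * a) := by
    calc (M : ℝ) ^ 6 ≤ Real.exp a ^ 6 := pow_le_pow_left₀ (by linarith) h 6
      _ = _ := by rw [← Real.exp_nat_mul]; norm_num
  have e5 : 3 * Real.exp (6 * a) ≤ Real.exp (7 * a) := by
    have : Real.exp (7 * a) = Real.exp a * Real.exp (6 * a) := by rw [← Real.exp_add]; ring_nf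
    rw [this]
    exact mul_le_mul_of_nonneg_right (by have := Real.add_one_le_exp a; linarith)
      (Real.exp_pos _).le
  have e6 : Real.exp (7 * a) ≤ (Real.exp b - 3) / 7 := by
    have h3 : (8 : ℝ) ≤ Real.exp 3 := by
      have : Real.exp 3 = Real.exp 2 * Real.exp 1 := by rw [← Real.exp_add]; norm_num
      nlinarith
    have h7 : Real.exp b = Real.exp (7 * a) * Real.exp 3 := by
      rw [← Real.exp_add, ha]; ring_nf
    have h8 := Real.add_one_le_exp (7 * a)
    rw [h7, le_div_iff₀ (by norm_num)]
    nlinarith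
  rw [e1]
  calc (2 : ℝ) ^ M * 4 ^ M ^ (r + 2) ≤ Real.exp ((M : ℝ) ^ 6) * Real.exp (2 * (M : ℝ) ^ 6) :=
        mul_le_mul e2 e3 (by positivity) (Real.exp_pos _).le
    _ = Real.exp (3 * (M : ℝ) ^ 6) := by rw [← Real.exp_add]; ring_nf
    _ ≤ _ := Real.exp_le_exp.2 (by linarith)

theorem ramseyBound_five_le {n : ℕ} (hn : 0 < n) {L : ℝ} (hL : 625 ≤ L) (hnL : (n : ℝ) ≤ L) :
    (ramseyBound 4 n 5 : ℝ) ≤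
      Real.exp ((Real.exp (Real.exp (Real.exp (Real.exp (Real.exp L)))) - 3) / 7) := by
  have up : ∀ b : ℝ, 17 ≤ b → 17 ≤ Real.exp b := fun b hb => by
    have := Real.add_one_le_exp b; linarith
  have h0 : (ramseyBound 4 n 0 : ℝ) ≤ Real.exp ((L - 3) / 7) := by
    have := Real.quadratic_le_exp_of_nonneg (x := (L - 3) / 7) (by linarith)
    simp only [ramseyBound]
    push_cast
    nlinarith
  have b0 : 17 ≤ L := by linarith
  have b1 := up _ b0
  have b2 := up _ b1
  have b3 := up _ b2
  have b4 := up _ b3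
  exact ramseyBound_succ_le hn (by norm_num) b4 (ramseyBound_succ_le hn (by norm_num) b3
    (ramseyBound_succ_le hn (by norm_num) b2 (ramseyBound_succ_le hn (by norm_num) b1
      (ramseyBound_succ_le hn (by norm_num) b0 h0))))

theorem nonnegRank_le_rows {m n : ℕ} {A : Matrix (Fin m) (Fin n) ℝ} (hA : ∀ i j, 0 ≤ A i j) :
    nonnegRank A ≤ m := by
  simpa using (hasNonnegFac_card hA Finset.univ).nonnegRank_le

/-- Blocks with `q = k` replace `k * k` rows by `5 * k + 3 ≤ 6 * k` terms; rows left over when no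
block can be found number fewer than twice the Ramsey bound. -/
theorem nonnegRank_le_of_rank_eq_three {m n : ℕ} {A : Matrix (Fin m) (Fin n) ℝ}
    (hA : ∀ i j, 0 ≤ A i j) (hr : A.rank = 3) {k : ℕ} (hk : 4 ≤ k) :
    (nonnegRank A : ℝ) ≤ 6 * m / k + 2 * ramseyBound 4 (k * k) 5 := by
  obtain ⟨S, hgen, hind⟩ := exists_minimal_generating A
  have hkk : 16 ≤ k * k := Nat.mul_le_mul hk hk
  have h1 := hasNonnegFac_of_blocks hA (t := k * k) (r := 4 * k + k + 3)
    (N := 2 * ramseyBound 4 (k * k) 5) (by omega) S fun T hT hTc =>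
      exists_block hA hr (fun b hb hcon => hind b (hT hb)
        (Submodule.span_mono (Set.image_mono (by
          exact_mod_cast Finset.erase_subset_erase b hT)) hcon))
        (by omega) (by omega) (by omega) (ramseyBound_pos (by norm_num) (by omega) 5) hTc
  have h2 := (h1.of_mem_span hgen).nonnegRank_le
  have h3 : S.card / (k * k) * (4 * k + k + 3) ≤ m / (k * k) * (6 * k) :=
    Nat.mul_le_mul (Nat.div_le_div_right (by simpa using S.card_le_univ)) (by omega)
  have h4 : (nonnegRank A : ℝ) ≤
      ((m / (k * k) : ℕ) : ℝ) * (6 * k) + 2 * ramseyBound 4 (k * k) 5 := by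
    exact_mod_cast h2.trans (Nat.add_le_add_right h3 _)
  have hk0 : (0 : ℝ) < k := by exact_mod_cast (by omega : 0 < k)
  have h5 : ((m / (k * k) : ℕ) : ℝ) * (6 * k) ≤ 6 * m / k := by
    calc ((m / (k * k) : ℕ) : ℝ) * (6 * k) ≤ (m / ((k * k : ℕ) : ℝ)) * (6 * k) :=
          mul_le_mul_of_nonneg_right Nat.cast_div_le (by positivity)
      _ = 6 * m / k := by
          push_cast
          field_simp
  linarith

theorem nonnegRank_le_iterated_log {m n : ℕ} {A : Matrix (Fin m) (Fin n) ℝ}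
    (hm : Real.exp (Real.exp (Real.exp (Real.exp (Real.exp 1)))) < (m : ℝ))
    (hA : ∀ i j, 0 ≤ A i j) (hr : A.rank = 3) :
    (nonnegRank A : ℝ) ≤ 25 * (m : ℝ) *
      (Real.log (Real.log (Real.log (Real.log (Real.log (Real.log (m : ℝ)))))))
        ^ (-(1 / 2) : ℝ) := by
  have step : ∀ {c t : ℝ}, Real.exp c < t → c < Real.log t ∧ Real.exp (Real.log t) = t := by
    intro c t h
    have ht := (Real.exp_pos c).trans h
    exact ⟨(Real.lt_log_iff_exp_lt ht).2 h, Real.exp_log ht⟩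
  obtain ⟨c1, d1⟩ := step hm
  obtain ⟨c2, d2⟩ := step c1
  obtain ⟨c3, d3⟩ := step c2
  obtain ⟨c4, d4⟩ := step c3
  obtain ⟨c5, d5⟩ := step c4
  have c6 := Real.log_pos c5
  have d6 := Real.exp_log (zero_lt_one.trans c5)
  set L := Real.log (Real.log (Real.log (Real.log (Real.log (Real.log (m : ℝ)))))) with hL
  have hlm : Real.log (m : ℝ) = Real.exp (Real.exp (Real.exp (Real.exp (Real.exp L)))) := by
    rw [d6, d5, d4, d3, d2]
  have hm0 : (0 : ℝ) < m := (Real.exp_pos _).trans hm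
  have hs0 : 0 < √L := Real.sqrt_pos.2 c6
  have hsq : √L * √L = L := Real.mul_self_sqrt c6.le
  rw [Real.rpow_neg c6.le, ← Real.sqrt_eq_rpow, ← div_eq_mul_inv]
  -- Below `625 = 25 ^ 2` the claim is weaker than the trivial bound `m`.
  rcases lt_or_ge L 625 with hL6 | hL6
  · have h25 : √L ≤ 25 := by
      rw [Real.sqrt_le_left (by norm_num)]
      linarith
    have h1 : (nonnegRank A : ℝ) ≤ m := by exact_mod_cast nonnegRank_le_rows hA
    refine h1.trans ((le_div_iff₀ hs0).2 ?_)
    nlinarith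
  · have h25 : 25 ≤ √L := Real.le_sqrt_of_sq_le (by linarith)
    have hk1 := Nat.floor_le hs0.le
    have hk2 := Nat.lt_floor_add_one (√L)
    set k := ⌊√L⌋₊ with hk
    have hk24 : (24 : ℝ) < k := by linarith
    have hk4 : 4 ≤ k := by
      have : (4 : ℝ) ≤ k := by linarith
      exact_mod_cast this
    have hkL : ((k * k : ℕ) : ℝ) ≤ L := by
      push_cast
      rw [← hsq]
      exact mul_le_mul hk1 hk1 (by positivity) hs0.le
    have h1 := nonnegRank_le_of_rank_eq_three hA hr hk4
    have h2 := ramseyBound_five_le (n := k * k) (by positivity) hL6 hkL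
    rw [← hlm] at h2
    have h3 : 6 * (m : ℝ) / k ≤ 12 * m / √L := by
      rw [div_le_div_iff₀ (by linarith) hs0]
      nlinarith
    -- The Ramsey bound is at most `m ^ (1 / 7)`, and so is `√L` up to a factor 7; the constant is
    -- `25 = 12 + 13`.
    have h4 : 2 * (ramseyBound 4 (k * k) 5 : ℝ) ≤ 13 * m / √L := by
      rw [le_div_iff₀ hs0]
      set lm := Real.log (m : ℝ) with hlm'
      have hLlm : L ≤ lm := by
        have up : ∀ t : ℝ, t ≤ Real.exp t := fun t => by
          have := Real.add_one_le_exp t; linarith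
        rw [hlm]
        exact (up _).trans ((up _).trans ((up _).trans ((up _).trans (up _))))
      have g1 : √L ≤ 7 * Real.exp (lm / 7) := by
        have := Real.add_one_le_exp (lm / 7)
        nlinarith
      have g2 : Real.exp ((lm - 3) / 7) ≤ Real.exp (lm / 7) := Real.exp_le_exp.2 (by linarith)
      have g3 : (ramseyBound 4 (k * k) 5 : ℝ) * √L ≤
          Real.exp (lm / 7) * (7 * Real.exp (lm / 7)) :=
        mul_le_mul (h2.trans g2) g1 hs0.le (Real.exp_pos _).le
      have g4 : (m : ℝ) = Real.exp (lm / 7) * Real.exp (lm / 7) * Real.exp (5 * lm / 7) := by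
        rw [← d1, ← Real.exp_add, ← Real.exp_add]; ring_nf
      have g5 : 2 ≤ Real.exp (5 * lm / 7) := by
        have := Real.add_one_le_exp (5 * lm / 7)
        linarith
      have g6 := mul_le_mul_of_nonneg_left g5
        (mul_pos (Real.exp_pos (lm / 7)) (Real.exp_pos (lm / 7))).le
      rw [← g4] at g6
      nlinarith
    have h5 : 25 * (m : ℝ) / √L = 12 * m / √L + 13 * m / √L := by ring
    linarith

theorem nonnegRank_le_transpose {m n : ℕ} {A : Matrix (Fin m) (Fin n) ℝ} (hA : ∀ i j, 0 ≤ A i j) :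
    nonnegRank A ≤ nonnegRank A.transpose := by
  obtain ⟨N, hN, hsum⟩ := isSumOfNonnegRankOne_nonnegRank A.transpose fun i j => hA j i
  refine Nat.sInf_le ⟨fun l => (N l).transpose, fun l => ⟨fun i j => (hN l).1 j i, ?_⟩, ?_⟩
  · rw [Matrix.rank_transpose]
    exact (hN l).2
  · rw [← Matrix.transpose_sum, ← hsum, Matrix.transpose_transpose]

theorem mainTheorem5 :
    (∀ (m n : ℕ) (A : Matrix (Fin m) (Fin n) ℝ),
      Real.exp (Real.exp (Real.exp (Real.exp (Real.exp 1)))) < (m : ℝ) →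
      (∀ i j, 0 ≤ A i j) → A.rank = 3 →
      (nonnegRank A : ℝ) ≤
        25 * (m : ℝ) *
          (Real.log (Real.log (Real.log (Real.log (Real.log (Real.log (m : ℝ)))))))
            ^ (-(1 / 2) : ℝ)) ∧
    (∃ f : ℕ → ℝ,
      f =o[Filter.atTop] (fun k : ℕ => (k : ℝ)) ∧
      ∀ (m n : ℕ) (A : Matrix (Fin m) (Fin n) ℝ),
        (∀ i j, 0 ≤ A i j) → A.rank = 3 →
        (nonnegRank A : ℝ) ≤ f m ∧ (nonnegRank A : ℝ) ≤ f n) := by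
  refine ⟨fun m n A hm hA hr => nonnegRank_le_iterated_log hm hA hr, ?_⟩
  set E := Real.exp (Real.exp (Real.exp (Real.exp (Real.exp 1)))) with hE
  let g : ℕ → ℝ := fun k =>
    (Real.log (Real.log (Real.log (Real.log (Real.log (Real.log (k : ℝ))))))) ^ (-(1 / 2) : ℝ)
  -- Where the iterated logarithm is unavailable the trivial bound is used; the bound in `n` comes
  -- from the transpose.
  let f : ℕ → ℝ := fun k => if E < (k : ℝ) then 25 * (k : ℝ) * g k else k
  have hf : ∀ (m n : ℕ) (A : Matrix (Fin m) (Fin n) ℝ), (∀ i j, 0 ≤ A i j) → A.rank = 3 →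
      (nonnegRank A : ℝ) ≤ f m := by
    intro m n A hA hr
    simp only [f]
    split_ifs with hm
    · exact nonnegRank_le_iterated_log hm hA hr
    · exact_mod_cast nonnegRank_le_rows hA
  refine ⟨f, ?_, fun m n A hA hr => ⟨hf m n A hA hr, ?_⟩⟩
  · have hlog := Real.tendsto_log_atTop
    have hg : Filter.Tendsto g Filter.atTop (nhds 0) :=
      (tendsto_rpow_neg_atTop (by norm_num : (0 : ℝ) < 1 / 2)).comp (hlog.comp (hlog.comp
        (hlog.comp (hlog.comp (hlog.comp (hlog.comp tendsto_natCast_atTop_atTop))))))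
    have h1 : (fun k : ℕ => 25 * (k : ℝ)) =O[Filter.atTop] (fun k : ℕ => (k : ℝ)) :=
      isBigO_const_mul_self _ _ _
    have h2 := h1.mul_isLittleO ((isLittleO_one_iff ℝ).2 hg)
    simp only [mul_one] at h2
    refine h2.congr' ?_ Filter.EventuallyEq.rfl
    filter_upwards [tendsto_natCast_atTop_atTop.eventually_gt_atTop E] with k hk
    simp only [f, hk, if_true]
  · refine le_trans ?_ (hf n m A.transpose (fun i j => hA j i) (by rw [Matrix.rank_transpose, hr]))
    exact_mod_cast nonnegRank_le_transpose hA
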